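/- Let $p$ be a prime, let $0<k<n$ be integers, and let $\mathbb{Z}/p$ act linearly on the unit sphere $S^n\subset\mathbb{R}^{n+1}$, i.e. each group element acts as the restriction of a linear map of $\mathbb{R}^{n+1}$. Suppose that the fixed point set is a standard sphere $(S^n)^{\mathbb{Z}/p}=S^k$, i.e. the intersection of $S^n$ with a $(k+1)$-dimensional linear subspace of $\mathbb{R}^{n+1}$. For a group $G$ and a $G$-space $X$, let $PX$ be the space of continuous paths $[0,1]\to X$ with the compact-open topology and the action $(g\gamma)(t)=g(\gamma(t))$, and let $G$ act on $X\times X$ by $g(x,y)=(gx,gy)$. The equivariant topological complexity $TC_G(X)$ is the least integer $m\ge 1$ such that $X\times X$ can be covered by $m$ open $G$-invariant sets $U_1,\dots,U_m$, each of which admits a $G$-equivariant motion planner, i.e. a continuous $G$-equivariant map $s_i\colon U_i\to PX$ such that $s_i(x,y)$ is a path from $x$ to $y$ for all $(x,y)\in U_i$ (and $TC_G(X)=\infty$ if no such $m$ exists). Then: 1. If both $n$ and $k$ are odd, then $TC_{\mathbb{Z}/p}(S^n)=2$. 2. If $n$ or $k$ is even, then $TC_{\mathbb{Z}/p}(S^n)=3$.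 -/

import Mathlib

open scoped unitInterval

/-- `U ⊆ X × X` is invariant for the diagonal action `g (x, y) = (g x, g y)` and admits a
`G`-equivariant motion planner, i.e. a continuous `G`-equivariant local section over `U` of the
path fibration `γ ↦ (γ 0, γ 1)`. The path space `C(I, X)` carries the compact-open topology and
the pointwise action `(g γ)(t) = g (γ t)`. -/
def HasEquivariantMotionPlanner (G : Type*) [Group G] (X : Type*) [TopologicalSpace X]
    [MulAction G X] [ContinuousConstSMul G X] (U : Set (X × X)) : Prop :=
  ∃ hU : ∀ (g : G), ∀ u ∈ U, g • u ∈ U,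
    ∃ s : C(U, C(I, X)),
      (∀ u : U, (s u 0, s u 1) = (u : X × X)) ∧
      (∀ (g : G) (u : U), s ⟨g • (u : X × X), hU g u u.2⟩ = g • s u)

/-- The equivariant topological complexity `TC_G(X)` (non-reduced): the least `m ≥ 1` such that
`X × X` is covered by `m` open `G`-invariant sets which admit `G`-equivariant motion planners;
it is `⊤` if there is no such `m`. -/
noncomputable def equivariantTC (G : Type*) [Group G] (X : Type*) [TopologicalSpace X]
    [MulAction G X] [ContinuousConstSMul G X] : ℕ∞ :=
  sInf {N : ℕ∞ | ∃ m : ℕ, N = m ∧ 1 ≤ m ∧ ∃ U : Fin m → Set (X × X),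
    (∀ i, IsOpen (U i)) ∧ (⋃ i, U i) = Set.univ ∧ ∀ i, HasEquivariantMotionPlanner G X (U i)}

/-- The standard sphere `S^n`, the unit sphere of `ℝ^(n+1)`. -/
abbrev StdSphere (n : ℕ) : Type :=
  Metric.sphere (0 : EuclideanSpace ℝ (Fin (n + 1))) 1

/-- An action on `S^n` is linear if each group element acts as the restriction of a linear map
of `ℝ^(n+1)` (such a map preserves the unit sphere, hence is orthogonal). -/
def IsLinearSphereAction (G : Type*) [Group G] (n : ℕ) [MulAction G (StdSphere n)] : Prop :=
  ∀ g : G, ∃ L : EuclideanSpace ℝ (Fin (n + 1)) →ₗ[ℝ] EuclideanSpace ℝ (Fin (n + 1)),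
    ∀ x : StdSphere n, ((g • x : StdSphere n) : EuclideanSpace ℝ (Fin (n + 1))) = L x

/-- `A` is a standard (unknotted) `k`-sphere in `S^n`: the intersection of `S^n` with a linear
subspace of `ℝ^(n+1)` of dimension `k + 1`. -/
def IsStdSubsphere (n k : ℕ) (A : Set (StdSphere n)) : Prop :=
  ∃ W : Submodule ℝ (EuclideanSpace ℝ (Fin (n + 1))), Module.finrank ℝ W = k + 1 ∧
    A = {x : StdSphere n | (x : EuclideanSpace ℝ (Fin (n + 1))) ∈ W}

/-! Upper bounds. On pairs with `x ≠ -y` the normalized segment from `x` to `y` is an equivariant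
planner, since the action is linear and orthogonal. On pairs with `x ≠ y` an equivariant tangent
field that does not vanish at `x` gives another: go from `x` to the field direction, on to `-x`, and
then to `y`. If `n` and `k` are odd, an injective skew map commuting with the group supplies a
nowhere zero field, so two sets suffice (`equivariantTC_le_two`). In general, since `k > 0`, there
are two orthogonal fixed unit vectors `e` and `f`. The tangential part of `e` is an equivariant
field vanishing only at `±e`, and the pairs it leaves out lie in a third set, where both points
avoid `-f` and contract to `f` (`equivariantTC_le_three`).

Lower bounds. An equivariant planner is in particular a planner, and over fixed pairs its paths
consist of fixed points. It is therefore enough to bound the ordinary complexity of the sphere,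
applied to `S^n` or to the fixed `S^k`. One set is impossible because the two projections `S × S →
S` are not homotopic. For two sets and an even-dimensional sphere, cutting off the planners yields
maps `f ≃ pr₁` and `g ≃ pr₂` of `S × S` to `S` such that near every point `f = pr₂` or `g = pr₁`.
The local alternating sum of the degrees of `(f, pr₁)`, `(f, g)`, `(pr₂, pr₁)`, `(pr₂, g)` then
vanishes. By homotopy invariance these are the degrees of `(pr₁, pr₁)`, `(pr₁, pr₂)`, `(pr₂, pr₁)`,
`(pr₂, pr₂)`, namely `0, 1, 1, 0`, because the swap of two even spheres preserves orientation. The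
alternating sum would be `-2`. This plays the role of the nonvanishing of the square of the
zero-divisor `1 ⊗ u - u ⊗ 1` in cohomology.

The degree is built analytically: maps are extended radially to `V × V`, smoothed by convolution,
and `ρ(F) det DF` is integrated against a cutoff, with `ρ` concentrated near `(a, -a)`. Only its
homotopy invariance (`integral_mul_comp_mul_det_eq`), its locality
(`shellDegree_alternating_sum_eq_zero`) and the zero or sign of four values are needed. -/

/-! ### Determinant identities and differentiation under the integral sign. -/

open MeasureTheory Module Function in
/-- Cramer's rule for the determinant form of a basis. -/
theorem Module.Basis.sum_det_update_smul {ι X : Type*} [Fintype ι] [DecidableEq ι]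
    [AddCommGroup X] [Module ℝ X] (b : Basis ι ℝ X) (v : ι → X) (w : X) :
    ∑ j, b.det (update v j w) • v j = b.det v • w := by
  apply b.repr.injective
  ext i
  have h := congrFun (Matrix.mulVec_cramer (b.toMatrix v) (b.repr w)) i
  simp only [Matrix.mulVec, dotProduct, Matrix.cramer_apply, Pi.smul_apply, smul_eq_mul] at h
  simp only [map_sum, map_smul, Finsupp.coe_finsetSum, Finset.sum_apply, Finsupp.coe_smul,
    Pi.smul_apply, smul_eq_mul, Basis.det_apply, Basis.toMatrix_update]
  rw [← h]
  exact Finset.sum_congr rfl fun j _ => mul_comm _ _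

open Function in
-- Exchanging `j` and `l` changes the sign of `δ` but not `s`, so the sum equals its own negative.
-- With second derivatives as `s`, this is why the cofactors of a Jacobian matrix are divergence
-- free.
theorem AlternatingMap.sum_sum_erase_update_update_eq_zero {ι X : Type*} [Fintype ι]
    [DecidableEq ι] [AddCommGroup X] [Module ℝ X] (δ : X [⋀^ι]→ₗ[ℝ] ℝ) (v : ι → X) (w : X)
    (s : ι → ι → X) (hs : ∀ i j, s i j = s j i) :
    ∑ j, ∑ l ∈ Finset.univ.erase j, δ (update (update v j w) l (s j l)) = 0 := by
  have hswap : ∀ j l, l ≠ j →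
      δ (update (update v j w) l (s j l)) = - δ (update (update v l w) j (s l j)) := by
    intro j l hjl
    rw [hs j l, ← δ.map_swap _ hjl]
    congr 1
    ext i
    by_cases h1 : i = j
    · subst h1; simp [hjl, hjl.symm]
    · by_cases h2 : i = l
      · subst h2; simp
      · simp [Equiv.swap_apply_of_ne_of_ne h2 h1, h1, h2]
  have h : ∑ j, ∑ l ∈ Finset.univ.erase j, δ (update (update v j w) l (s j l)) =
      - ∑ j, ∑ l ∈ Finset.univ.erase j, δ (update (update v j w) l (s j l)) := by
    calc _ = ∑ j, ∑ l ∈ Finset.univ.erase j, - δ (update (update v l w) j (s l j)) :=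
          Finset.sum_congr rfl fun j _ => Finset.sum_congr rfl fun l hl =>
            hswap j l (Finset.ne_of_mem_erase hl)
      _ = - ∑ j, ∑ l ∈ Finset.univ.erase j, δ (update (update v l w) j (s l j)) := by
          simp only [Finset.sum_neg_distrib]
      _ = _ := by
          congr 1
          apply Finset.sum_comm'
          intro x y
          simp [eq_comm]
  linarith

open MeasureTheory Set Filter Topology in
/-- Differentiation under the integral sign for jointly continuous integrands which vanish
outside a fixed compact set. -/
theorem hasDerivAt_integral_of_continuous_of_isCompact {X : Type*} [TopologicalSpace X] [T2Space X]
    [MeasurableSpace X] [OpensMeasurableSpace X] {μ : Measure X} [IsFiniteMeasureOnCompacts μ]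
    [SecondCountableTopology X]
    {f f' : ℝ → X → ℝ} {K : Set X} (hK : IsCompact K)
    (hf : Continuous (Function.uncurry f)) (hf' : Continuous (Function.uncurry f'))
    (hfK : ∀ t, ∀ z ∉ K, f t z = 0) (hfK' : ∀ t, ∀ z ∉ K, f' t z = 0)
    (hd : ∀ t z, HasDerivAt (fun s => f s z) (f' t z) t) (t : ℝ) :
    HasDerivAt (fun s => ∫ z, f s z ∂μ) (∫ z, f' t z ∂μ) t := by
  have hc : ∀ s, Continuous (f s) := fun s => hf.comp (by fun_prop : Continuous fun z => (s, z))
  have hc' : ∀ s, Continuous (f' s) := fun s => hf'.comp (by fun_prop : Continuous fun z => (s, z))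
  have hs : ∀ s, HasCompactSupport (f s) := fun s => HasCompactSupport.intro hK (hfK s)
  obtain ⟨C, hC⟩ := ((isCompact_closedBall t 1).prod hK).exists_bound_of_continuousOn
    hf'.continuousOn
  refine (hasDerivAt_integral_of_dominated_loc_of_deriv_le (s := Metric.closedBall t 1)
    (bound := K.indicator fun _ => C)
    (Metric.closedBall_mem_nhds t one_pos) (Eventually.of_forall fun s => ?_)
    ?_ ?_ ?_ ?_ ?_).2
  · exact (hc s).aestronglyMeasurable
  · exact (hc t).integrable_of_hasCompactSupport (hs t)
  · exact (hc' t).aestronglyMeasurable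
  · refine Eventually.of_forall fun z s hsb => ?_
    by_cases hz : z ∈ K
    · rw [indicator_of_mem hz]
      exact hC (s, z) ⟨hsb, hz⟩
    · rw [indicator_of_notMem hz, hfK' s z hz, norm_zero]
  · exact (integrable_indicator_iff hK.measurableSet).2 (integrableOn_const hK.measure_ne_top)
  · exact Eventually.of_forall fun z s _ => hd s z

/-- The determinant form of a basis of a finite dimensional space, as a continuous alternating
map. -/
noncomputable def Module.Basis.detL {ι X : Type*} [Fintype ι] [DecidableEq ι]
    [NormedAddCommGroup X] [NormedSpace ℝ X] (b : Module.Basis ι ℝ X) : X [⋀^ι]→L[ℝ] ℝ :=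
  { b.det with
    cont := by
      have : FiniteDimensional ℝ X := b.finiteDimensional_of_finite
      change Continuous fun v => b.det v
      simp only [Module.Basis.det_apply]
      refine Continuous.matrix_det (continuous_matrix fun i j => ?_)
      exact (LinearMap.continuous_of_finiteDimensional (b.coord i)).comp (continuous_apply j) }

theorem Module.Basis.detL_apply {ι X : Type*} [Fintype ι] [DecidableEq ι]
    [NormedAddCommGroup X] [NormedSpace ℝ X] (b : Module.Basis ι ℝ X) (v : ι → X) :
    b.detL v = b.det v := rfl

theorem Module.Basis.detL_map {ι X : Type*} [Fintype ι] [DecidableEq ι]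
    [NormedAddCommGroup X] [NormedSpace ℝ X] (b : Module.Basis ι ℝ X) (A : X →L[ℝ] X) :
    b.detL (fun i => A (b i)) = A.det := by
  rw [b.detL_apply]
  have := b.det_comp (A : X →ₗ[ℝ] X) b
  rw [b.det_self, mul_one] at this
  exact this

/-! ### Homotopy invariance of the integral of `ρ(F) det DF`. -/

section Homotopy

open MeasureTheory Module Function

variable {ι X : Type*} [DecidableEq ι] [NormedAddCommGroup X] [NormedSpace ℝ X]

theorem hasFDerivAt_update_fderiv {b : Basis ι ℝ X} {F w : X → X} (hF : ContDiff ℝ 2 F)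
    (hw : ContDiff ℝ 2 w) (j : ι) (z : X) (l : ι) :
    HasFDerivAt (fun z => update (fun l => fderiv ℝ F z (b l)) j (w z) l)
      (update (fun l => (ContinuousLinearMap.apply ℝ X (b l)).comp (fderiv ℝ (fderiv ℝ F) z)) j
        (fderiv ℝ w z) l) z := by
  by_cases h : l = j
  · subst h
    simpa using (hw.differentiable (by norm_num) z).hasFDerivAt
  · simp only [update_of_ne h]
    have hd : DifferentiableAt ℝ (fderiv ℝ F) z :=
      (hF.fderiv_right (m := 1) (by norm_num)).differentiable (by norm_num) z
    exact (ContinuousLinearMap.apply ℝ X (b l)).hasFDerivAt.comp z hd.hasFDerivAt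

variable [Fintype ι]

/-- The `j`-th coordinate of the vector field whose divergence is the variation of
`ρ(F) det DF` in the direction `w`. -/
noncomputable def detFlux (b : Basis ι ℝ X) (ρ : X → ℝ) (F w : X → X) (j : ι) (z : X) : ℝ :=
  ρ (F z) * b.detL (update (fun l => fderiv ℝ F z (b l)) j (w z))

/-- The variation of `ρ(F) det DF` in the direction `w`. -/
noncomputable def detVariation (b : Basis ι ℝ X) (ρ : X → ℝ) (F w : X → X) (z : X) : ℝ :=
  fderiv ℝ ρ (F z) (w z) * b.detL (fun l => fderiv ℝ F z (b l)) +
    ρ (F z) * ∑ j, b.detL (update (fun l => fderiv ℝ F z (b l)) j (fderiv ℝ w z (b j)))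

theorem ContinuousAlternatingMap.hasFDerivAt_comp_pi {E : Type*} [NormedAddCommGroup E]
    [NormedSpace ℝ E] (δ : X [⋀^ι]→L[ℝ] ℝ) {g : E → ι → X} {g' : ι → E →L[ℝ] X} {z : E}
    (hg : ∀ i, HasFDerivAt (fun z => g z i) (g' i) z) :
    HasFDerivAt (fun z => δ (g z)) ((δ.1.linearDeriv (g z)).comp (ContinuousLinearMap.pi g')) z :=
  (δ.hasFDerivAt (g z)).comp z (hasFDerivAt_pi.2 hg)

/-- The product rule gives three kinds of terms: Cramer's rule assembles those with `Dρ`, those with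
`Dw` are kept, and those with `D²F` cancel by symmetry of second derivatives. -/
theorem sum_fderiv_detFlux (b : Basis ι ℝ X) {ρ : X → ℝ} {F w : X → X} (hρ : ContDiff ℝ 1 ρ)
    (hF : ContDiff ℝ 2 F) (hw : ContDiff ℝ 2 w) (z : X) :
    ∑ j, fderiv ℝ (detFlux b ρ F w j) z (b j) = detVariation b ρ F w z := by
  set A : ι → X := fun l => fderiv ℝ F z (b l) with hA
  have hsym : ∀ i j, fderiv ℝ (fderiv ℝ F) z (b i) (b j) = fderiv ℝ (fderiv ℝ F) z (b j) (b i) :=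
    fun i j => (hF.contDiffAt.isSymmSndFDerivAt (by simp)) (b i) (b j)
  have key : ∀ j, fderiv ℝ (detFlux b ρ F w j) z (b j) =
      b.detL (update A j (w z)) * fderiv ℝ ρ (F z) (A j) +
      ρ (F z) * (b.detL (update A j (fderiv ℝ w z (b j))) +
        ∑ l ∈ Finset.univ.erase j,
          b.detL (update (update A j (w z)) l (fderiv ℝ (fderiv ℝ F) z (b j) (b l)))) := by
    intro j
    have h1 : HasFDerivAt (fun z => ρ (F z)) ((fderiv ℝ ρ (F z)).comp (fderiv ℝ F z)) z :=
      (hρ.differentiable (by norm_num) (F z)).hasFDerivAt.comp z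
        (hF.differentiable (by norm_num) z).hasFDerivAt
    have h2 := b.detL.hasFDerivAt_comp_pi (hasFDerivAt_update_fderiv (b := b) hF hw j z)
    have h3 : HasFDerivAt (detFlux b ρ F w j) _ z := h1.mul h2
    rw [h3.fderiv]
    simp only [_root_.add_apply, _root_.smul_apply, ContinuousLinearMap.comp_apply,
      ContinuousMultilinearMap.linearDeriv_apply, smul_eq_mul, ContinuousLinearMap.coe_pi']
    rw [← Finset.add_sum_erase _ _ (Finset.mem_univ j), add_comm]
    congr 2
    congr 1
    · simp [update_idem]
      rfl
    · refine Finset.sum_congr rfl fun l hl => ?_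
      rw [update_of_ne (Finset.ne_of_mem_erase hl)]
      rfl
  simp only [key, Finset.sum_add_distrib, ← Finset.mul_sum]
  rw [detVariation]
  have hc := congrArg (fderiv ℝ ρ (F z)) (b.sum_det_update_smul A (w z))
  simp only [map_sum, map_smul, smul_eq_mul] at hc
  have hz := b.det.sum_sum_erase_update_update_eq_zero A (w z)
    (fun j l => fderiv ℝ (fderiv ℝ F) z (b j) (b l)) hsym
  simp only [b.detL_apply]
  rw [hc, hz]
  ring

theorem hasDerivAt_comp_mul_det (b : Basis ι ℝ X) {ρ : X → ℝ} {F w : X → X} (hρ : ContDiff ℝ 1 ρ)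
    (hF : ContDiff ℝ 2 F) (hw : ContDiff ℝ 2 w) (z : X) (t : ℝ) :
    HasDerivAt (fun s : ℝ => ρ (F z + s • w z) *
        b.detL (fun l => fderiv ℝ (fun z => F z + s • w z) z (b l)))
      (detVariation b ρ (fun z => F z + t • w z) w z) t := by
  have hfd : ∀ s : ℝ, fderiv ℝ (fun z => F z + s • w z) z = fderiv ℝ F z + s • fderiv ℝ w z := by
    intro s
    have h1 := (hF.differentiable (by norm_num) z).hasFDerivAt
    have h2 := (hw.differentiable (by norm_num) z).hasFDerivAt
    exact (h1.add (h2.const_smul s)).fderiv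
  have hline : ∀ (x y : X), HasDerivAt (fun s : ℝ => x + s • y) y t := by
    intro x y
    simpa using ((hasDerivAt_id t).smul_const y).const_add x
  have h1 : HasDerivAt (fun s : ℝ => ρ (F z + s • w z)) (fderiv ℝ ρ (F z + t • w z) (w z)) t :=
    (hρ.differentiable (by norm_num) _).hasFDerivAt.comp_hasDerivAt t (hline _ _)
  have h2 := b.detL.hasFDerivAt_comp_pi
    (g := fun (s : ℝ) l => fderiv ℝ F z (b l) + s • fderiv ℝ w z (b l))
    (fun l => (hline (fderiv ℝ F z (b l)) (fderiv ℝ w z (b l))).hasFDerivAt)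
  have h3 := h1.mul h2.hasDerivAt
  simp only [detVariation, hfd]
  convert! h3 using 1
  simp only [ContinuousLinearMap.comp_apply, ContinuousMultilinearMap.linearDeriv_apply]
  simp

theorem contDiff_detFlux (b : Basis ι ℝ X) {ρ : X → ℝ} {F w : X → X} (hρ : ContDiff ℝ 1 ρ)
    (hF : ContDiff ℝ 2 F) (hw : ContDiff ℝ 2 w) (j : ι) : ContDiff ℝ 1 (detFlux b ρ F w j) := by
  have hF' : ContDiff ℝ 1 (fderiv ℝ F) := hF.fderiv_right (by norm_num)
  refine (hρ.comp (hF.of_le (by norm_num))).mul (b.detL.contDiff.comp (contDiff_pi.2 fun l => ?_))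
  by_cases h : l = j
  · subst h
    simpa using hw.of_le (by norm_num)
  · simp only [update_of_ne h]
    exact hF'.clm_apply contDiff_const

theorem continuous_detVariation_line (b : Basis ι ℝ X) {ρ : X → ℝ} {F w : X → X}
    (hρ : ContDiff ℝ 1 ρ) (hF : ContDiff ℝ 2 F) (hw : ContDiff ℝ 2 w) :
    Continuous fun p : ℝ × X => detVariation b ρ (fun z => F z + p.1 • w z) w p.2 := by
  have hfd : ∀ (s : ℝ) z, fderiv ℝ (fun z => F z + s • w z) z =
      fderiv ℝ F z + s • fderiv ℝ w z := fun s z =>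
    ((hF.differentiable (by norm_num) z).hasFDerivAt.add
      ((hw.differentiable (by norm_num) z).hasFDerivAt.const_smul s)).fderiv
  have hF' := hF.continuous_fderiv (by norm_num)
  have hw' := hw.continuous_fderiv (by norm_num)
  have hρ' := hρ.continuous_fderiv (by norm_num)
  have hFc := hF.continuous
  have hwc := hw.continuous
  have hρc := hρ.continuous
  have hδ := b.detL.cont
  have hA : Continuous fun (p : ℝ × X) (l : ι) => (fderiv ℝ F p.2 + p.1 • fderiv ℝ w p.2) (b l) := by
    fun_prop
  have hδc : ∀ {g : ℝ × X → ι → X}, Continuous g → Continuous fun p => b.detL (g p) :=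
    fun hg => hδ.comp hg
  simp only [detVariation, hfd]
  refine ((hρ'.comp ?_).clm_apply ?_ |>.mul (hδc hA)).add ((hρc.comp ?_).mul
    (continuous_finsetSum _ fun j _ => hδc (hA.update j ?_)))
  all_goals fun_prop

variable [MeasurableSpace X] [BorelSpace X] {μ : Measure X} [μ.IsAddHaarMeasure]

/-- The variation is a divergence, so integration by parts moves the derivative onto `χ`; wherever
`Dχ ≠ 0` the flux vanishes through its factor `ρ(F)`. -/
theorem integral_mul_detVariation (b : Basis ι ℝ X) {χ ρ : X → ℝ} {F w : X → X}
    (hχ : ContDiff ℝ 1 χ) (hχc : HasCompactSupport χ) (hρ : ContDiff ℝ 1 ρ)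
    (hF : ContDiff ℝ 2 F) (hw : ContDiff ℝ 2 w)
    (h0 : ∀ z, fderiv ℝ χ z ≠ 0 → ρ (F z) = 0) :
    ∫ z, χ z * detVariation b ρ F w z ∂μ = 0 := by
  have : FiniteDimensional ℝ X := b.finiteDimensional_of_finite
  have hflux := contDiff_detFlux b hρ hF hw
  have hχ' := hχ.continuous_fderiv (by norm_num)
  have hint : ∀ j, Integrable (fun z => χ z * fderiv ℝ (detFlux b ρ F w j) z (b j)) μ := fun j =>
    Continuous.integrable_of_hasCompactSupport
      (hχ.continuous.mul (((hflux j).continuous_fderiv (by norm_num)).clm_apply continuous_const))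
      hχc.mul_right
  simp only [← sum_fderiv_detFlux b hρ hF hw, Finset.mul_sum]
  rw [integral_finsetSum _ fun j _ => hint j]
  refine Finset.sum_eq_zero fun j _ => ?_
  rw [integral_mul_fderiv_eq_neg_fderiv_mul_of_integrable _ (hint j) _
    (fun z _ => hχ.differentiable (by norm_num) z)
    (fun z _ => (hflux j).differentiable (by norm_num) z)]
  · rw [neg_eq_zero]
    refine integral_eq_zero_of_ae (Filter.Eventually.of_forall fun z => ?_)
    by_cases h : fderiv ℝ χ z = 0
    · simp [h]
    · simp [detFlux, h0 z h]
  · exact Continuous.integrable_of_hasCompactSupport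
      ((hχ'.clm_apply continuous_const).mul (hflux j).continuous)
      (hχc.fderiv_apply ℝ (b j)).mul_right
  · exact Continuous.integrable_of_hasCompactSupport
      (hχ.continuous.mul (hflux j).continuous) hχc.mul_right

/-- The integral of `ρ(F) det DF` against a cutoff `χ` is invariant under linear homotopies along
which `ρ(F)` vanishes where `χ` is not locally constant. -/
theorem integral_mul_comp_mul_det_eq {χ ρ : X → ℝ} {F G : X → X} [FiniteDimensional ℝ X]
    (hχ : ContDiff ℝ 1 χ) (hχc : HasCompactSupport χ) (hρ : ContDiff ℝ 1 ρ)
    (hF : ContDiff ℝ 2 F) (hG : ContDiff ℝ 2 G)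
    (h0 : ∀ z, fderiv ℝ χ z ≠ 0 → ∀ t ∈ Set.Icc (0 : ℝ) 1, ρ (F z + t • (G z - F z)) = 0) :
    ∫ z, χ z * (ρ (F z) * (fderiv ℝ F z).det) ∂μ =
      ∫ z, χ z * (ρ (G z) * (fderiv ℝ G z).det) ∂μ := by
  let b := Module.finBasis ℝ X
  let w : X → X := fun z => G z - F z
  have hw : ContDiff ℝ 2 w := hG.sub hF
  let f : ℝ → X → ℝ := fun s z => χ z * (ρ (F z + s • w z) *
        b.detL (fun l => fderiv ℝ (fun z => F z + s • w z) z (b l)))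
  let f' : ℝ → X → ℝ := fun s z => χ z * detVariation b ρ (fun z => F z + s • w z) w z
  have hχ0 : ∀ z ∉ tsupport χ, χ z = 0 := fun z hz => image_eq_zero_of_notMem_tsupport hz
  have hfc : Continuous (Function.uncurry f) := by
    have hfd : ∀ (s : ℝ) z, fderiv ℝ (fun z => F z + s • w z) z =
        fderiv ℝ F z + s • fderiv ℝ w z := fun s z =>
      ((hF.differentiable (by norm_num) z).hasFDerivAt.add
        ((hw.differentiable (by norm_num) z).hasFDerivAt.const_smul s)).fderiv
    have hF' := hF.continuous_fderiv (by norm_num)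
    have hw' := hw.continuous_fderiv (by norm_num)
    have hFc := hF.continuous
    have hwc := hw.continuous
    have hρc := hρ.continuous
    have hχc := hχ.continuous
    simp only [f, hfd, Function.uncurry_def]
    refine (hχc.comp continuous_snd).mul ((hρc.comp (by fun_prop)).mul (b.detL.cont.comp ?_))
    fun_prop
  have hd := hasDerivAt_integral_of_continuous_of_isCompact (μ := μ) (f := f) (f' := f')
    hχc.isCompact hfc
    ((hχ.continuous.comp continuous_snd).mul (continuous_detVariation_line b hρ hF hw))
    (fun t z hz => by simp [f, hχ0 z hz]) (fun t z hz => by simp [f', hχ0 z hz])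
    (fun t z => (hasDerivAt_comp_mul_det b hρ hF hw z t).const_mul (χ z))
  have hz : ∀ t ∈ Set.Icc (0 : ℝ) 1, ∫ z, f' t z ∂μ = 0 := fun t ht =>
    integral_mul_detVariation b hχ hχc hρ (hF.add (hw.const_smul t)) hw fun z hz => h0 z hz t ht
  have hconst := constant_of_has_deriv_right_zero (a := 0) (b := 1)
    (f := fun s => ∫ z, f s z ∂μ)
    (fun t _ => (hd t).continuousAt.continuousWithinAt)
    (fun t ht => hz t (Set.Ico_subset_Icc_self ht) ▸ (hd t).hasDerivWithinAt) 1 (by simp)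
  simp only [f, w, b.detL_map] at hconst
  simpa using hconst.symm

end Homotopy

/-! ### Smoothing by convolution. -/

section Mollify

open MeasureTheory Metric Topology

variable {X : Type*} [NormedAddCommGroup X] [NormedSpace ℝ X] [FiniteDimensional ℝ X]
  [MeasurableSpace X] [BorelSpace X]

/-- Convolution with a normalized bump function. -/
noncomputable def mollify (φ : ContDiffBump (0 : X)) (F : X → X) : X → X :=
  convolution (φ.normed Measure.addHaar) F (ContinuousLinearMap.lsmul ℝ ℝ) Measure.addHaar

theorem contDiff_mollify (φ : ContDiffBump (0 : X)) {F : X → X} (hF : Continuous F) :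
    ContDiff ℝ 2 (mollify φ F) :=
  φ.hasCompactSupport_normed.contDiff_convolution_left _ φ.contDiff_normed
    hF.locallyIntegrable

theorem norm_mollify_sub_le (φ : ContDiffBump (0 : X)) {F : X → X} (hF : Continuous F) {x : X}
    {ε : ℝ} (h : ∀ y ∈ ball x φ.rOut, dist (F y) (F x) ≤ ε) : ‖mollify φ F x - F x‖ ≤ ε := by
  rw [← dist_eq_norm]
  exact φ.dist_normed_convolution_le hF.aestronglyMeasurable h

theorem mollify_congr (φ : ContDiffBump (0 : X)) {F G : X → X} {x : X}
    (h : ∀ y ∈ ball x φ.rOut, F y = G y) : mollify φ F x = mollify φ G x := by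
  simp only [mollify, convolution_def]
  refine integral_congr_ae (Filter.Eventually.of_forall fun t => ?_)
  by_cases ht : t ∈ ball (0 : X) φ.rOut
  · have : x - t ∈ ball x φ.rOut := by simpa [mem_ball, dist_eq_norm] using ht
    simp only [h _ this]
  · have : φ.normed Measure.addHaar t = 0 := by
      rw [← Function.notMem_support, φ.support_normed_eq]
      exact ht
    simp [this]

/-- The margin between `φ.rOut` and `ε` gives agreement on a neighbourhood, hence also of
derivatives at `x`. -/
theorem mollify_eventuallyEq (φ : ContDiffBump (0 : X)) {F G : X → X} {x : X} {ε : ℝ}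
    (hε : φ.rOut < ε) (h : ∀ y ∈ ball x ε, F y = G y) : mollify φ F =ᶠ[𝓝 x] mollify φ G := by
  filter_upwards [ball_mem_nhds x (sub_pos.2 hε)] with y hy
  refine mollify_congr φ fun z hz => h z ?_
  have := dist_triangle z y x
  rw [mem_ball] at *
  linarith

end Mollify

/-! ### A degree for maps near pairs of unit vectors. -/

section Shell

open MeasureTheory Metric Topology

variable {V : Type*} [NormedAddCommGroup V]

/-- Pairs of vectors whose squared norms differ from `1` by at most `r`. -/
def shell (V : Type*) [NormedAddCommGroup V] (r : ℝ) : Set (V × V) :=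
  {z | |‖z.1‖ ^ 2 - 1| ≤ r ∧ |‖z.2‖ ^ 2 - 1| ≤ r}

theorem isClosed_shell (r : ℝ) : IsClosed (shell V r) := by
  have h1 : Continuous fun z : V × V => |‖z.1‖ ^ 2 - 1| := by fun_prop
  have h2 : Continuous fun z : V × V => |‖z.2‖ ^ 2 - 1| := by fun_prop
  exact (isClosed_le h1 continuous_const).inter (isClosed_le h2 continuous_const)

theorem ne_zero_of_mem_shell {r : ℝ} (hr : r < 1) {z : V × V} (hz : z ∈ shell V r) :
    z.1 ≠ 0 ∧ z.2 ≠ 0 := by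
  obtain ⟨h1, h2⟩ := hz
  rw [abs_le] at h1 h2
  constructor <;> intro h <;> simp [h] at h1 h2 <;> linarith

theorem shell_mem_nhds {r s : ℝ} (hrs : r < s) {z : V × V} (hz : z ∈ shell V r) :
    shell V s ∈ 𝓝 z := by
  have h1 : Continuous fun z : V × V => |‖z.1‖ ^ 2 - 1| := by fun_prop
  have h2 : Continuous fun z : V × V => |‖z.2‖ ^ 2 - 1| := by fun_prop
  have h : IsOpen {z : V × V | |‖z.1‖ ^ 2 - 1| < s ∧ |‖z.2‖ ^ 2 - 1| < s} :=
    (isOpen_lt h1 continuous_const).inter (isOpen_lt h2 continuous_const)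
  filter_upwards [h.mem_nhds ⟨hz.1.trans_lt hrs, hz.2.trans_lt hrs⟩] with w hw
  exact ⟨hw.1.le, hw.2.le⟩

/-- The cutoff function `(x, y) ↦ β(‖x‖²) β(‖y‖²)`. -/
noncomputable def shellCutoff (β : ContDiffBump (1 : ℝ)) (z : V × V) : ℝ :=
  β (‖z.1‖ ^ 2) * β (‖z.2‖ ^ 2)

theorem shellCutoff_eq_one (β : ContDiffBump (1 : ℝ)) {r : ℝ} (hr : r ≤ β.rIn) {z : V × V}
    (hz : z ∈ shell V r) : shellCutoff β z = 1 := by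
  rw [shellCutoff, β.one_of_mem_closedBall, β.one_of_mem_closedBall, one_mul]
  · exact mem_closedBall.2 (hz.2.trans hr)
  · exact mem_closedBall.2 (hz.1.trans hr)

theorem tsupport_shellCutoff_subset (β : ContDiffBump (1 : ℝ)) :
    tsupport (shellCutoff (V := V) β) ⊆ shell V β.rOut := by
  refine closure_minimal (fun z hz => ?_) (isClosed_shell _)
  have h1 := left_ne_zero_of_mul (Function.mem_support.1 hz)
  have h2 := right_ne_zero_of_mul (Function.mem_support.1 hz)
  rw [← Function.mem_support, β.support_eq, mem_ball, Real.dist_eq] at h1 h2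
  exact ⟨h1.le, h2.le⟩

/-- The inner cutoff profile. -/
noncomputable def innerProfile : ContDiffBump (1 : ℝ) := ⟨1 / 4, 1 / 2, by norm_num, by norm_num⟩

/-- The outer cutoff profile, which is `1` near the support of the inner one. -/
noncomputable def outerProfile : ContDiffBump (1 : ℝ) := ⟨3 / 5, 4 / 5, by norm_num, by norm_num⟩

theorem outer_eventually_eq_one {z : V × V} (hz : z ∈ shell V (1 / 2)) :
    ∀ᶠ w in 𝓝 z, shellCutoff outerProfile w = 1 := by
  filter_upwards [shell_mem_nhds (s := 3 / 5) (by norm_num) hz] with w hw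
  exact shellCutoff_eq_one outerProfile le_rfl hw

theorem mem_shell_of_inner_ne_zero {z : V × V} (hz : shellCutoff innerProfile z ≠ 0) :
    z ∈ shell V (1 / 2) :=
  tsupport_shellCutoff_subset innerProfile (subset_tsupport _ hz)

variable [InnerProductSpace ℝ V]

theorem contDiff_shellCutoff (β : ContDiffBump (1 : ℝ)) {n : ℕ∞} :
    ContDiff ℝ n (shellCutoff (V := V) β) :=
  (β.contDiff.comp ((contDiff_norm_sq ℝ).comp contDiff_fst)).mul
    (β.contDiff.comp ((contDiff_norm_sq ℝ).comp contDiff_snd))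

theorem isCompact_shell [FiniteDimensional ℝ V] (r : ℝ) : IsCompact (shell V r) := by
  refine (isCompact_closedBall (0 : V × V) (2 + |r|)).of_isClosed_subset (isClosed_shell r) ?_
  rintro ⟨x, y⟩ ⟨hx, hy⟩
  have hr := le_abs_self r
  have hr0 := abs_nonneg r
  simp only [abs_le] at hx hy
  rw [mem_closedBall_zero_iff, Prod.norm_mk, max_le_iff]
  constructor <;> nlinarith [norm_nonneg x, norm_nonneg y]

theorem hasCompactSupport_shellCutoff [FiniteDimensional ℝ V] (β : ContDiffBump (1 : ℝ)) :
    HasCompactSupport (shellCutoff (V := V) β) :=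
  (isCompact_shell _).of_isClosed_subset (isClosed_tsupport _) (tsupport_shellCutoff_subset β)

theorem mem_shell_of_fderiv_inner_ne_zero {z : V × V}
    (hz : fderiv ℝ (shellCutoff innerProfile) z ≠ 0) : z ∈ shell V (1 / 2) :=
  tsupport_shellCutoff_subset innerProfile
    (support_fderiv_subset ℝ (Function.mem_support.2 hz))

theorem fderiv_inner_eq_zero {r : ℝ} (hr : r < 1 / 4) {z : V × V} (hz : z ∈ shell V r) :
    fderiv ℝ (shellCutoff innerProfile) z = 0 := by
  have : shellCutoff innerProfile =ᶠ[𝓝 z] fun _ => (1 : ℝ) := by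
    filter_upwards [shell_mem_nhds (s := 1 / 4) hr hz] with w hw
    exact shellCutoff_eq_one innerProfile le_rfl hw
  rw [this.fderiv_eq, fderiv_fun_const]
  rfl

variable [FiniteDimensional ℝ V] [MeasurableSpace V] [BorelSpace V]

/-- The number of preimages of points near `(a, -a)`, counted with sign and weighted by `ρ`. -/
noncomputable def shellDegree (ρ : V × V → ℝ) (F : V × V → V × V) : ℝ :=
  ∫ z, shellCutoff innerProfile z * (ρ (F z) * (fderiv ℝ F z).det) ∂Measure.addHaar

/-- The segment from `F z` to `G z` stays within `1/20` of `P z`. If it meets the support of `ρ`,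
then `P z` is within `1/10` of `(a, -a)`. As `P` preserves norms, `z` is then too close to the unit
shell for the cutoff to vary. -/
theorem shellDegree_eq {a : V} (ha : ‖a‖ = 1) {ρ : V × V → ℝ} (hρ : ContDiff ℝ 1 ρ)
    (hρa : ∀ z, ρ z ≠ 0 → ‖z - (a, -a)‖ < 1 / 20) {F G P : V × V → V × V}
    (hF : ContDiff ℝ 2 F) (hG : ContDiff ℝ 2 G)
    (hP : ∀ z ∈ shell V (1 / 2), ‖(P z).1‖ = ‖z.1‖ ∧ ‖(P z).2‖ = ‖z.2‖)
    (hFP : ∀ z, ‖F z - P z‖ ≤ 1 / 20) (hGP : ∀ z, ‖G z - P z‖ ≤ 1 / 20) :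
    shellDegree ρ F = shellDegree ρ G := by
  refine integral_mul_comp_mul_det_eq (contDiff_shellCutoff (n := 1) _)
    (hasCompactSupport_shellCutoff _) hρ hF hG ?_
  intro z hz t ht
  by_contra hne
  -- Norms within `1/10` of `1` have squares within `1.1² - 1 = 0.21` of `1`, less than the inner
  -- radius `1/4`.
  refine hz (fderiv_inner_eq_zero (r := 0.21) (by norm_num) ?_)
  have hconv : F z + t • (G z - F z) ∈ closedBall (P z) (1 / 20) :=
    (convex_closedBall (P z) (1 / 20)).add_smul_sub_mem
      (by simpa [dist_eq_norm] using hFP z) (by simpa [dist_eq_norm] using hGP z) ht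
  rw [mem_closedBall, dist_eq_norm] at hconv
  have h1 := hρa _ hne
  have h2 : ‖P z - (a, -a)‖ ≤ 1 / 10 := by
    have := norm_sub_le_norm_sub_add_norm_sub (P z) (F z + t • (G z - F z)) (a, -a)
    rw [norm_sub_rev] at hconv
    linarith
  obtain ⟨hP1, hP2⟩ := hP z (mem_shell_of_fderiv_inner_ne_zero hz)
  have h3 : |‖z.1‖ - 1| ≤ 1 / 10 := by
    have h := (abs_norm_sub_norm_le _ _).trans ((norm_fst_le (P z - (a, -a))).trans h2)
    rwa [hP1, ha] at h
  have h4 : |‖z.2‖ - 1| ≤ 1 / 10 := by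
    have h := (abs_norm_sub_norm_le _ _).trans ((norm_snd_le (P z - (a, -a))).trans h2)
    rwa [hP2, norm_neg, ha] at h
  rw [abs_le] at h3 h4
  refine ⟨abs_le.2 ⟨?_, ?_⟩, abs_le.2 ⟨?_, ?_⟩⟩ <;> nlinarith

end Shell

/-! ### Degrees of pairs of sphere valued maps. -/

section Family

open MeasureTheory Metric Topology

variable {V : Type*} [NormedAddCommGroup V]

/-- Pairs of nonzero vectors. -/
def nonzeroPairs (V : Type*) [NormedAddCommGroup V] : Set (V × V) := {z | z.1 ≠ 0 ∧ z.2 ≠ 0}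

theorem isOpen_nonzeroPairs : IsOpen (nonzeroPairs V) :=
  (isOpen_ne.preimage continuous_fst).inter (isOpen_ne.preimage continuous_snd)

theorem shell_subset_nonzeroPairs {r : ℝ} (hr : r < 1) : shell V r ⊆ nonzeroPairs V :=
  fun _ hz => ne_zero_of_mem_shell hr hz

theorem tsupport_outer_subset : tsupport (shellCutoff (V := V) outerProfile) ⊆ nonzeroPairs V :=
  (tsupport_shellCutoff_subset _).trans
    (shell_subset_nonzeroPairs (by norm_num [outerProfile]))

variable [InnerProductSpace ℝ V]

/-- The extension of a pair of sphere valued maps on pairs of nonzero vectors to a map which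
preserves norms near the unit shell. -/
noncomputable def shellMap (f g : V × V → V) (z : V × V) : V × V :=
  shellCutoff outerProfile z • (‖z.1‖ • f z, ‖z.2‖ • g z)

theorem shellMap_eventuallyEq (f g : V × V → V) {z : V × V} (hz : z ∈ shell V (1 / 2)) :
    shellMap f g =ᶠ[𝓝 z] fun z => (‖z.1‖ • f z, ‖z.2‖ • g z) := by
  filter_upwards [outer_eventually_eq_one hz] with w hw
  simp [shellMap, hw]

theorem shellMap_eq (f g : V × V → V) {z : V × V} (hz : z ∈ shell V (1 / 2)) :
    shellMap f g z = (‖z.1‖ • f z, ‖z.2‖ • g z) :=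
  (shellMap_eventuallyEq f g hz).eq_of_nhds

theorem contDiff_shellMap {f g : V × V → V} (hf : ContDiffOn ℝ 2 f (nonzeroPairs V))
    (hg : ContDiffOn ℝ 2 g (nonzeroPairs V)) : ContDiff ℝ 2 (shellMap f g) := by
  refine contDiff_iff_contDiffAt.2 fun z => ?_
  by_cases hz : z ∈ tsupport (shellMap f g)
  swap
  · exact contDiffAt_const.congr_of_eventuallyEq (notMem_tsupport_iff_eventuallyEq.1 hz)
  have hz' : z ∈ nonzeroPairs V := tsupport_outer_subset (tsupport_smul_subset_left _ _ hz)
  have hn := isOpen_nonzeroPairs.mem_nhds hz'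
  refine (contDiff_shellCutoff (n := 2) _).contDiffAt.smul (ContDiffAt.prodMk ?_ ?_)
  · exact ((contDiffAt_norm ℝ hz'.1).comp z contDiffAt_fst).smul (hf.contDiffAt hn)
  · exact ((contDiffAt_norm ℝ hz'.2).comp z contDiffAt_snd).smul (hg.contDiffAt hn)

variable [FiniteDimensional ℝ V]

theorem continuous_shellMap_family {f g : I × (V × V) → V}
    (hf : ContinuousOn f (Set.univ ×ˢ nonzeroPairs V))
    (hg : ContinuousOn g (Set.univ ×ˢ nonzeroPairs V)) :
    Continuous (fun p : I × (V × V) => shellMap (fun z => f (p.1, z)) (fun z => g (p.1, z)) p.2) ∧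
    HasCompactSupport
      (fun p : I × (V × V) => shellMap (fun z => f (p.1, z)) (fun z => g (p.1, z)) p.2) := by
  have hsub : tsupport
      (fun p : I × (V × V) => shellMap (fun z => f (p.1, z)) (fun z => g (p.1, z)) p.2) ⊆
      Set.univ ×ˢ tsupport (shellCutoff (V := V) outerProfile) := by
    refine closure_minimal (fun p hp => ⟨trivial, subset_tsupport _ ?_⟩)
      (isClosed_univ.prod (isClosed_tsupport _))
    rw [Function.mem_support] at hp ⊢
    exact fun h => hp (by simp [shellMap, h])
  constructor
  · have hc := (contDiff_shellCutoff (V := V) (n := 0) outerProfile).continuous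
    refine ContinuousOn.continuous_of_tsupport_subset (s := Set.univ ×ˢ nonzeroPairs V) ?_
      (isOpen_univ.prod isOpen_nonzeroPairs)
      (hsub.trans (Set.prod_mono le_rfl tsupport_outer_subset))
    simp only [shellMap]
    refine (by fun_prop : Continuous fun p : I × (V × V) =>
      shellCutoff outerProfile p.2).continuousOn.smul (ContinuousOn.prodMk ?_ ?_)
    · exact (by fun_prop : Continuous fun p : I × (V × V) => ‖p.2.1‖).continuousOn.smul hf
    · exact (by fun_prop : Continuous fun p : I × (V × V) => ‖p.2.2‖).continuousOn.smul hg
  · exact (isCompact_univ.prod (hasCompactSupport_shellCutoff _).isCompact).of_isClosed_subset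
      (isClosed_tsupport _) hsub

variable [MeasurableSpace V] [BorelSpace V]

/-- Homotopy invariance of the degree: the time one map of a homotopy may have to be smoothed. -/
theorem exists_shellDegree_mollify_eq {a : V} (ha : ‖a‖ = 1) {ρ : V × V → ℝ}
    (hρ : ContDiff ℝ 1 ρ) (hρa : ∀ z, ρ z ≠ 0 → ‖z - (a, -a)‖ < 1 / 20)
    {Q : I × (V × V) → V × V} (hQ : Continuous Q) (hQc : HasCompactSupport Q)
    (hQn : ∀ t, ∀ z ∈ shell V (1 / 2), ‖(Q (t, z)).1‖ = ‖z.1‖ ∧ ‖(Q (t, z)).2‖ = ‖z.2‖)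
    (hQ0 : ContDiff ℝ 2 fun z => Q (0, z)) :
    ∃ ε > 0, ∀ φ : ContDiffBump (0 : V × V), φ.rOut < ε →
      shellDegree ρ (mollify φ fun z => Q (1, z)) = shellDegree ρ fun z => Q (0, z) := by
  have hu : UniformContinuous Q := hQc.uniformContinuous_of_continuous hQ
  -- Half of the tolerance `1/20` pays for the smoothing, the other half for the change of time.
  obtain ⟨ε, hε, h⟩ := Metric.uniformContinuous_iff.1 hu (1 / 40) (by norm_num)
  refine ⟨ε, hε, fun φ hφ => ?_⟩
  have hQt : ∀ t, Continuous fun z => Q (t, z) := fun t => by fun_prop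
  have hmol : ∀ t z, ‖mollify φ (fun z => Q (t, z)) z - Q (t, z)‖ ≤ 1 / 40 := fun t z =>
    norm_mollify_sub_le φ (hQt t) fun y hy =>
      (h (by simpa [Prod.dist_eq] using (mem_ball.1 hy).trans hφ)).le
  -- One bump serves all times, so the degree is locally constant on the connected interval.
  have hloc : IsLocallyConstant fun t : I => shellDegree ρ (mollify φ fun z => Q (t, z)) := by
    rw [IsLocallyConstant.iff_eventually_eq]
    intro t
    filter_upwards [ball_mem_nhds t hε] with s hs
    refine shellDegree_eq ha hρ hρa (contDiff_mollify φ (hQt s)) (contDiff_mollify φ (hQt t))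
      (hQn t) (fun z => ?_) (fun z => (hmol t z).trans (by norm_num))
    have h1 : ‖Q (s, z) - Q (t, z)‖ < 1 / 40 := by
      rw [← dist_eq_norm]
      exact h (by simpa [Prod.dist_eq] using hs)
    have h2 := norm_sub_le_norm_sub_add_norm_sub (mollify φ (fun z => Q (s, z)) z) (Q (s, z))
      (Q (t, z))
    linarith [hmol s z]
  calc shellDegree ρ (mollify φ fun z => Q (1, z))
      = shellDegree ρ (mollify φ fun z => Q (0, z)) := hloc.apply_eq_of_preconnectedSpace 1 0
    _ = shellDegree ρ fun z => Q (0, z) :=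
      shellDegree_eq ha hρ hρa (contDiff_mollify φ (hQt 0)) hQ0 (hQn 0)
        (fun z => (hmol 0 z).trans (by norm_num)) (fun z => by simp)

/-- Homotopy invariance of the degree for pairs of homotopies of sphere valued maps. -/
theorem exists_shellDegree_shellMap_eq {a : V} (ha : ‖a‖ = 1) {ρ : V × V → ℝ}
    (hρ : ContDiff ℝ 1 ρ) (hρa : ∀ z, ρ z ≠ 0 → ‖z - (a, -a)‖ < 1 / 20)
    {f g : I × (V × V) → V}
    (hf : ContinuousOn f (Set.univ ×ˢ nonzeroPairs V))
    (hg : ContinuousOn g (Set.univ ×ˢ nonzeroPairs V))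
    (hf1 : ∀ t, ∀ z ∈ nonzeroPairs V, ‖f (t, z)‖ = 1)
    (hg1 : ∀ t, ∀ z ∈ nonzeroPairs V, ‖g (t, z)‖ = 1)
    (hf0 : ContDiffOn ℝ 2 (fun z => f (0, z)) (nonzeroPairs V))
    (hg0 : ContDiffOn ℝ 2 (fun z => g (0, z)) (nonzeroPairs V)) :
    ∃ ε > 0, ∀ φ : ContDiffBump (0 : V × V), φ.rOut < ε →
      shellDegree ρ (mollify φ (shellMap (fun z => f (1, z)) fun z => g (1, z))) =
        shellDegree ρ (shellMap (fun z => f (0, z)) fun z => g (0, z)) := by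
  obtain ⟨h1, h2⟩ := continuous_shellMap_family hf hg
  refine exists_shellDegree_mollify_eq ha hρ hρa h1 h2 (fun t z hz => ?_)
    (contDiff_shellMap hf0 hg0)
  have hz' := shell_subset_nonzeroPairs (by norm_num) hz
  simp [shellMap_eq _ _ hz, norm_smul, hf1 t z hz', hg1 t z hz']

theorem integrable_shellDegree {ρ : V × V → ℝ} (hρ : Continuous ρ) {F : V × V → V × V}
    (hF : ContDiff ℝ 2 F) :
    Integrable (fun z => shellCutoff innerProfile z * (ρ (F z) * (fderiv ℝ F z).det))
      Measure.addHaar :=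
  Continuous.integrable_of_hasCompactSupport
    ((contDiff_shellCutoff (n := 0) _).continuous.mul ((hρ.comp hF.continuous).mul
      (ContinuousLinearMap.continuous_det.comp (hF.continuous_fderiv (by norm_num)))))
    (hasCompactSupport_shellCutoff _).mul_right

/-- Additivity: if near every point of the shell two maps agree in one of the two components, then
the alternating sum of the four degrees vanishes. -/
theorem shellDegree_alternating_sum_eq_zero {ρ : V × V → ℝ} (hρ : Continuous ρ)
    {f₁ f₂ g₁ g₂ : V × V → V} (h11 : Continuous (shellMap f₁ g₁)) (h12 : Continuous (shellMap f₁ g₂))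
    (h21 : Continuous (shellMap f₂ g₁)) (h22 : Continuous (shellMap f₂ g₂)) {ε : ℝ}
    (h : ∀ z ∈ shell V (1 / 2), (∀ w ∈ ball z ε, f₁ w = f₂ w) ∨ (∀ w ∈ ball z ε, g₁ w = g₂ w))
    (φ : ContDiffBump (0 : V × V)) (hφ : φ.rOut < ε) :
    shellDegree ρ (mollify φ (shellMap f₁ g₁)) - shellDegree ρ (mollify φ (shellMap f₁ g₂)) -
      shellDegree ρ (mollify φ (shellMap f₂ g₁)) + shellDegree ρ (mollify φ (shellMap f₂ g₂)) =
        0 := by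
  have i11 := integrable_shellDegree hρ (contDiff_mollify φ h11)
  have i12 := integrable_shellDegree hρ (contDiff_mollify φ h12)
  have i21 := integrable_shellDegree hρ (contDiff_mollify φ h21)
  have i22 := integrable_shellDegree hρ (contDiff_mollify φ h22)
  simp only [shellDegree]
  rw [← integral_sub' i11 i12, ← integral_sub' (i11.sub i12) i21,
    ← integral_add' ((i11.sub i12).sub i21) i22]
  refine integral_eq_zero_of_ae (Filter.Eventually.of_forall fun z => ?_)
  by_cases hz : shellCutoff innerProfile z = 0
  · simp [hz]
  -- Agreement in one component near `z` makes the integrands at `z` equal in pairs of opposite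
  -- sign.
  rcases h z (mem_shell_of_inner_ne_zero hz) with h | h
  · have e1 : mollify φ (shellMap f₁ g₁) =ᶠ[𝓝 z] mollify φ (shellMap f₂ g₁) :=
      mollify_eventuallyEq φ hφ fun w hw => by simp [shellMap, h w hw]
    have e2 : mollify φ (shellMap f₁ g₂) =ᶠ[𝓝 z] mollify φ (shellMap f₂ g₂) :=
      mollify_eventuallyEq φ hφ fun w hw => by simp [shellMap, h w hw]
    simp only [e1.eq_of_nhds, e2.eq_of_nhds, e1.fderiv_eq, e2.fderiv_eq, Pi.zero_apply,
      Pi.sub_apply, Pi.add_apply]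
    ring
  · have e1 : mollify φ (shellMap f₁ g₁) =ᶠ[𝓝 z] mollify φ (shellMap f₁ g₂) :=
      mollify_eventuallyEq φ hφ fun w hw => by simp [shellMap, h w hw]
    have e2 : mollify φ (shellMap f₂ g₁) =ᶠ[𝓝 z] mollify φ (shellMap f₂ g₂) :=
      mollify_eventuallyEq φ hφ fun w hw => by simp [shellMap, h w hw]
    simp only [e1.eq_of_nhds, e2.eq_of_nhds, e1.fderiv_eq, e2.fderiv_eq, Pi.zero_apply,
      Pi.sub_apply, Pi.add_apply]
    ring

end Family

/-! ### The determinant of the swap. -/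

section Swap

variable {V : Type*} [AddCommGroup V] [Module ℝ V]

/-- The linear automorphism `(x, y) ↦ (x + y, x - y)`. -/
noncomputable def sumDiffEquiv (V : Type*) [AddCommGroup V] [Module ℝ V] : (V × V) ≃ₗ[ℝ] V × V where
  toFun z := (z.1 + z.2, z.1 - z.2)
  invFun z := ((1 / 2 : ℝ) • (z.1 + z.2), (1 / 2 : ℝ) • (z.1 - z.2))
  map_add' z w := by ext <;> simp <;> abel
  map_smul' c z := by ext <;> simp [smul_sub]
  left_inv z := by
    ext <;> simp <;> module
  right_inv z := by
    ext <;> simp <;> module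

/-- In the coordinates `x + y` and `x - y` the swap is the identity on one factor and `-1` on the
other. -/
theorem LinearMap.det_prodComm [FiniteDimensional ℝ V] :
    LinearMap.det ((LinearEquiv.prodComm ℝ V V : (V × V) ≃ₗ[ℝ] V × V) : (V × V) →ₗ[ℝ] V × V) =
      (-1) ^ Module.finrank ℝ V := by
  have h : ((LinearEquiv.prodComm ℝ V V : (V × V) ≃ₗ[ℝ] V × V) : (V × V) →ₗ[ℝ] V × V) =
      (sumDiffEquiv V : (V × V) →ₗ[ℝ] V × V) ∘ₗ
        LinearMap.prodMap LinearMap.id ((-1 : ℝ) • LinearMap.id) ∘ₗ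
          ((sumDiffEquiv V).symm : (V × V) →ₗ[ℝ] V × V) := by
    refine LinearMap.ext fun z => ?_
    obtain ⟨w, rfl⟩ := (sumDiffEquiv V).surjective z
    ext <;> simp [sumDiffEquiv] <;> module
  rw [h, LinearMap.det_conj, LinearMap.det_prodMap, LinearMap.det_smul, LinearMap.det_id,
    one_mul, mul_one]

end Swap

/-! ### The degrees of the four pairs of projections. -/

section Evaluation

open MeasureTheory Metric Topology

variable {V : Type*} [NormedAddCommGroup V] [InnerProductSpace ℝ V]

/-- The direction of the first component. -/
noncomputable def unitFst (z : V × V) : V := ‖z.1‖⁻¹ • z.1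

/-- The direction of the second component. -/
noncomputable def unitSnd (z : V × V) : V := ‖z.2‖⁻¹ • z.2

theorem contDiffOn_unitFst : ContDiffOn ℝ 2 (unitFst (V := V)) (nonzeroPairs V) := fun z hz =>
  ((((contDiffAt_norm ℝ hz.1).comp z contDiffAt_fst).inv (norm_ne_zero_iff.2 hz.1)).smul
    contDiffAt_fst).contDiffWithinAt

theorem contDiffOn_unitSnd : ContDiffOn ℝ 2 (unitSnd (V := V)) (nonzeroPairs V) := fun z hz =>
  ((((contDiffAt_norm ℝ hz.2).comp z contDiffAt_snd).inv (norm_ne_zero_iff.2 hz.2)).smul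
    contDiffAt_snd).contDiffWithinAt

theorem norm_unitFst {z : V × V} (hz : z ∈ nonzeroPairs V) : ‖unitFst z‖ = 1 := by
  simp [unitFst, norm_smul, norm_ne_zero_iff.2 hz.1]

theorem norm_unitSnd {z : V × V} (hz : z ∈ nonzeroPairs V) : ‖unitSnd z‖ = 1 := by
  simp [unitSnd, norm_smul, norm_ne_zero_iff.2 hz.2]

theorem norm_smul_unitFst {z : V × V} (hz : z ∈ nonzeroPairs V) : ‖z.1‖ • unitFst z = z.1 := by
  simp [unitFst, smul_smul, norm_ne_zero_iff.2 hz.1]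

theorem norm_smul_unitSnd {z : V × V} (hz : z ∈ nonzeroPairs V) : ‖z.2‖ • unitSnd z = z.2 := by
  simp [unitSnd, smul_smul, norm_ne_zero_iff.2 hz.2]

/-- The inner product of `u` with `a` would be positive while its multiple by `c ≥ 0` would be
negative. -/
theorem not_near_both {a : V} (ha : ‖a‖ = 1) {u : V} {c : ℝ} (hc : 0 ≤ c)
    (h1 : ‖u - a‖ < 1 / 20) (h2 : ‖c • u + a‖ < 1 / 20) : False := by
  have haa : inner ℝ a a = 1 := by rw [real_inner_self_eq_norm_sq, ha]; norm_num
  have e1 := (abs_real_inner_le_norm (u - a) a).trans_lt (by rwa [ha, mul_one])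
  have e2 := (abs_real_inner_le_norm (c • u + a) a).trans_lt (by rwa [ha, mul_one])
  rw [inner_sub_left, haa, abs_lt] at e1
  rw [inner_add_left, inner_smul_left, haa, abs_lt] at e2
  simp only [conj_trivial] at e2
  nlinarith

/-- The map `(x, y) ↦ (‖x‖ y / ‖y‖, ‖y‖ x / ‖x‖)`, which exchanges the directions. -/
noncomputable def swapDirections (z : V × V) : V × V := (‖z.1‖ • unitSnd z, ‖z.2‖ • unitFst z)

theorem swapDirections_swapDirections {z : V × V} (hz : z ∈ nonzeroPairs V) :
    swapDirections (swapDirections z) = z := by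
  have h1 := norm_ne_zero_iff.2 hz.1
  have h2 := norm_ne_zero_iff.2 hz.2
  ext <;> simp [swapDirections, unitFst, unitSnd, norm_smul, smul_smul, h1, h2]

theorem contDiffAt_swapDirections {z : V × V} (hz : z ∈ nonzeroPairs V) :
    ContDiffAt ℝ 2 swapDirections z :=
  (((contDiffAt_norm ℝ hz.1).comp z contDiffAt_fst).smul
    (contDiffOn_unitSnd.contDiffAt (isOpen_nonzeroPairs.mem_nhds hz))).prodMk
  (((contDiffAt_norm ℝ hz.2).comp z contDiffAt_snd).smul
    (contDiffOn_unitFst.contDiffAt (isOpen_nonzeroPairs.mem_nhds hz)))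

theorem hasFDerivAt_norm_of_norm_eq_one {u : V} (hu : ‖u‖ = 1) :
    HasFDerivAt (fun x : V => ‖x‖) (innerSL ℝ u) u := by
  have h := (hasStrictFDerivAt_norm_sq u).hasFDerivAt.sqrt (by simp [hu])
  simp only [Real.sqrt_sq (norm_nonneg _), hu] at h
  convert! h using 1
  ext x
  simp

variable [FiniteDimensional ℝ V] {a : V}

/-- The varying norms turn the derivative into the linear swap composed with a reflection, which
contributes the extra sign. -/
theorem det_fderiv_swapDirections (ha : ‖a‖ = 1) :
    (fderiv ℝ swapDirections (-a, a)).det = - (-1) ^ Module.finrank ℝ V := by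
  have ha' : ‖-a‖ = 1 := by rwa [norm_neg]
  let fs := ContinuousLinearMap.fst ℝ V V
  let sn := ContinuousLinearMap.snd ℝ V V
  have hf : HasFDerivAt (fun z : V × V => ‖z.1‖) ((innerSL ℝ (-a)).comp fs) (-a, a) :=
    (hasFDerivAt_norm_of_norm_eq_one ha').comp (-a, a) fs.hasFDerivAt
  have hs : HasFDerivAt (fun z : V × V => ‖z.2‖) ((innerSL ℝ a).comp sn) (-a, a) :=
    (hasFDerivAt_norm_of_norm_eq_one ha).comp (-a, a) sn.hasFDerivAt
  have hfi := (hasDerivAt_inv (x := ‖(-a, a).1‖) (by simp [ha])).comp_hasFDerivAt (-a, a) hf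
  have hsi := (hasDerivAt_inv (x := ‖(-a, a).2‖) (by simp [ha])).comp_hasFDerivAt (-a, a) hs
  have h : HasFDerivAt (swapDirections (V := V)) _ (-a, a) :=
    (hf.smul (hsi.smul sn.hasFDerivAt)).prodMk (hs.smul (hfi.smul fs.hasFDerivAt))
  rw [h.fderiv]
  let ℓ : Module.Dual ℝ (V × V) := LinearMap.coprod (innerSL ℝ a : V →L[ℝ] ℝ) (innerSL ℝ a : V →L[ℝ] ℝ)
  have hT : LinearMap.det ((LinearEquiv.prodComm ℝ V V : (V × V) →ₗ[ℝ] V × V) ∘ₗ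
      LinearMap.transvection ℓ (-(a, a))) = - (-1) ^ Module.finrank ℝ V := by
    -- The transvection has determinant `1 + ℓ(-(a, a)) = 1 - 2 = -1`.
    rw [LinearMap.det_comp, LinearMap.det_prodComm, LinearMap.transvection.det]
    have : ℓ (-(a, a)) = -2 := by simp [ℓ, ha]; norm_num
    rw [this]
    ring
  rw [← hT, ContinuousLinearMap.det]
  congr 1
  refine LinearMap.ext fun z => ?_
  ext
  · simp [ha, ℓ, fs, sn, LinearMap.transvection]
    module
  · simp [ha, ℓ, fs, sn, LinearMap.transvection, unitFst]
    module

variable [MeasurableSpace V] [BorelSpace V] {ρ : V × V → ℝ}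

/-- On the shell both components of the image are nonnegative multiples of one vector, so they
cannot be near `a` and `-a`. This is the reason for centring `ρ` at an antipodal pair. -/
theorem shellDegree_unitFst_unitFst (ha : ‖a‖ = 1)
    (hρa : ∀ z, ρ z ≠ 0 → ‖z - (a, -a)‖ < 1 / 20) :
    shellDegree ρ (shellMap unitFst unitFst) = 0 := by
  refine integral_eq_zero_of_ae (Filter.Eventually.of_forall fun z => ?_)
  by_cases hz : shellCutoff innerProfile z = 0
  · simp [hz]
  have hz := mem_shell_of_inner_ne_zero hz
  have hzn := shell_subset_nonzeroPairs (by norm_num) hz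
  by_cases hr : ρ (shellMap unitFst unitFst z) = 0
  · simp [hr]
  have h := hρa _ hr
  rw [shellMap_eq _ _ hz, norm_smul_unitFst hzn, unitFst, smul_smul] at h
  refine (not_near_both ha (u := z.1) (c := ‖z.2‖ * ‖z.1‖⁻¹) (by positivity)
    ((norm_fst_le _).trans_lt h) ?_).elim
  simpa using (norm_snd_le _).trans_lt h

theorem shellDegree_unitSnd_unitSnd (ha : ‖a‖ = 1)
    (hρa : ∀ z, ρ z ≠ 0 → ‖z - (a, -a)‖ < 1 / 20) :
    shellDegree ρ (shellMap unitSnd unitSnd) = 0 := by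
  refine integral_eq_zero_of_ae (Filter.Eventually.of_forall fun z => ?_)
  by_cases hz : shellCutoff innerProfile z = 0
  · simp [hz]
  have hz := mem_shell_of_inner_ne_zero hz
  have hzn := shell_subset_nonzeroPairs (by norm_num) hz
  by_cases hr : ρ (shellMap unitSnd unitSnd z) = 0
  · simp [hr]
  have h := hρa _ hr
  rw [shellMap_eq _ _ hz, norm_smul_unitSnd hzn, unitSnd, smul_smul] at h
  refine (not_near_both (a := -a) (by rwa [norm_neg]) (u := z.2) (c := ‖z.1‖ * ‖z.2‖⁻¹)
    (by positivity) ((norm_snd_le _).trans_lt h) ?_).elim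
  simpa [sub_eq_add_neg] using (norm_fst_le _).trans_lt h

/-- Near the support of the cutoff the map is the identity, so the integrand is the cutoff times
`ρ`. -/
theorem shellDegree_unitFst_unitSnd_pos (ha : ‖a‖ = 1) (hρ : Continuous ρ) (hρ0 : ∀ z, 0 ≤ ρ z)
    (hρa : ρ (a, -a) ≠ 0) : 0 < shellDegree ρ (shellMap unitFst unitSnd) := by
  have hid : ∀ z ∈ shell V (1 / 2), shellMap unitFst unitSnd =ᶠ[𝓝 z] id := by
    intro z hz
    filter_upwards [shellMap_eventuallyEq unitFst unitSnd hz,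
      isOpen_nonzeroPairs.mem_nhds (shell_subset_nonzeroPairs (by norm_num) hz)] with w hw hwn
    rw [hw, norm_smul_unitFst hwn, norm_smul_unitSnd hwn]
    rfl
  have heq : ∀ z, shellCutoff innerProfile z * (ρ (shellMap unitFst unitSnd z) *
      (fderiv ℝ (shellMap unitFst unitSnd) z).det) = shellCutoff innerProfile z * ρ z := by
    intro z
    by_cases hz : shellCutoff innerProfile z = 0
    · simp [hz]
    have hz := hid z (mem_shell_of_inner_ne_zero hz)
    rw [hz.fderiv_eq, hz.eq_of_nhds, fderiv_id]
    simp [ContinuousLinearMap.det]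
  simp only [shellDegree, heq]
  refine Continuous.integral_pos_of_hasCompactSupport_nonneg_nonzero (x := (a, -a))
    ((contDiff_shellCutoff (n := 0) _).continuous.mul hρ)
    (hasCompactSupport_shellCutoff _).mul_right
    (fun z => mul_nonneg (mul_nonneg innerProfile.nonneg innerProfile.nonneg) (hρ0 z)) ?_
  rw [shellCutoff_eq_one (r := 0) innerProfile (by norm_num [innerProfile]) (by simp [shell, ha])]
  simpa using hρa

/-- `swapDirections` is an involution, so whatever it sends near `(a, -a)` lies near `(-a, a)`,
where its Jacobian is positive in odd dimension. -/
theorem exists_shellDegree_unitSnd_unitFst_nonneg (ha : ‖a‖ = 1)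
    (hV : Odd (Module.finrank ℝ V)) :
    ∃ δ > 0, ∀ ρ : V × V → ℝ, (∀ z, 0 ≤ ρ z) → (∀ z, ρ z ≠ 0 → ‖z - (a, -a)‖ < δ) →
      0 ≤ shellDegree ρ (shellMap unitSnd unitFst) := by
  have ha0 : a ≠ 0 := by rintro rfl; simp at ha
  have h1 : swapDirections (a, -a) = (-a, a) := by simp [swapDirections, unitFst, unitSnd, ha]
  have hc1 : ContinuousAt swapDirections (a, -a) :=
    (contDiffAt_swapDirections ⟨ha0, neg_ne_zero.2 ha0⟩).continuousAt
  have hc2 : ContinuousAt (fun z => (fderiv ℝ (swapDirections (V := V)) z).det) (-a, a) :=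
    ContinuousLinearMap.continuous_det.continuousAt.comp
      ((contDiffAt_swapDirections ⟨neg_ne_zero.2 ha0, ha0⟩).fderiv_right
        (m := 0) (by norm_num)).continuousAt
  have hpos : ∀ᶠ z in 𝓝 (-a, a), 0 < (fderiv ℝ (swapDirections (V := V)) z).det := by
    refine hc2.eventually_const_lt ?_
    change 0 < (fderiv ℝ swapDirections (-a, a)).det
    rw [det_fderiv_swapDirections ha, hV.neg_one_pow]
    norm_num
  rw [← h1] at hpos
  obtain ⟨δ, hδ, h⟩ := Metric.eventually_nhds_iff.1 (hc1.eventually hpos)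
  refine ⟨δ, hδ, fun ρ hρ0 hρ => integral_nonneg fun z => ?_⟩
  by_cases hz : shellCutoff innerProfile z = 0
  · simp [hz]
  have hz := mem_shell_of_inner_ne_zero hz
  refine mul_nonneg (mul_nonneg innerProfile.nonneg innerProfile.nonneg) ?_
  have he : shellMap unitSnd unitFst =ᶠ[𝓝 z] swapDirections := shellMap_eventuallyEq _ _ hz
  by_cases hr : ρ (shellMap unitSnd unitFst z) = 0
  · simp [hr]
  have h2 := hρ _ hr
  rw [he.eq_of_nhds, ← dist_eq_norm] at h2
  have h3 := h h2
  rw [swapDirections_swapDirections (shell_subset_nonzeroPairs (by norm_num) hz)] at h3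
  rw [he.fderiv_eq]
  exact mul_nonneg (hρ0 _) h3.le

end Evaluation

/-! ### Nonexistence of deformations between the projections. -/

section Obstruction

open MeasureTheory Metric Topology

variable {V : Type*} [NormedAddCommGroup V] [InnerProductSpace ℝ V]

/-- The direction of each component of a pair of nonzero vectors. -/
noncomputable def normalizePair (z : nonzeroPairs V) :
    sphere (0 : V) 1 × sphere (0 : V) 1 :=
  (⟨unitFst z.1, by simpa using norm_unitFst z.2⟩, ⟨unitSnd z.1, by simpa using norm_unitSnd z.2⟩)

theorem continuous_normalizePair : Continuous (normalizePair (V := V)) :=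
  (contDiffOn_unitFst.continuousOn.domRestrict.subtype_mk _).prodMk
    (contDiffOn_unitSnd.continuousOn.domRestrict.subtype_mk _)

open Classical in
/-- The extension of a map on pairs of unit vectors, by a given map where it is not defined. -/
noncomputable def extendPairs (h : I × (sphere (0 : V) 1 × sphere (0 : V) 1) → sphere (0 : V) 1)
    (d : V × V → V) (p : I × (V × V)) : V :=
  if hp : p.2 ∈ nonzeroPairs V then h (p.1, normalizePair ⟨p.2, hp⟩) else d p.2

theorem extendPairs_of_mem
    (h : I × (sphere (0 : V) 1 × sphere (0 : V) 1) → sphere (0 : V) 1) (d : V × V → V) (t : I)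
    {z : V × V} (hz : z ∈ nonzeroPairs V) :
    extendPairs h d (t, z) = h (t, normalizePair ⟨z, hz⟩) := by
  simp [extendPairs, hz]

theorem continuousOn_extendPairs
    {h : I × (sphere (0 : V) 1 × sphere (0 : V) 1) → sphere (0 : V) 1} (hh : Continuous h)
    (d : V × V → V) : ContinuousOn (extendPairs h d) (Set.univ ×ˢ nonzeroPairs V) := by
  rw [continuousOn_iff_continuous_domRestrict]
  have hc : Continuous fun p : (Set.univ ×ˢ nonzeroPairs V : Set (I × (V × V))) =>
      ((h (p.1.1, normalizePair ⟨p.1.2, p.2.2⟩) : sphere (0 : V) 1) : V) := by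
    have h1 : Continuous fun p : (Set.univ ×ˢ nonzeroPairs V : Set (I × (V × V))) =>
        (⟨p.1.2, p.2.2⟩ : nonzeroPairs V) := by fun_prop
    have h2 := continuous_normalizePair.comp h1
    fun_prop
  convert! hc using 1
  funext p
  exact extendPairs_of_mem h d p.1.1 p.2.2

variable [FiniteDimensional ℝ V]

theorem exists_contDiffBump_radius_lt {X : Type*} [NormedAddCommGroup X] [NormedSpace ℝ X] (c : X)
    {r : ℝ} (hr : 0 < r) : ∃ φ : ContDiffBump c, φ.rOut < r :=
  ⟨⟨r / 4, r / 2, by linarith, by linarith⟩, by dsimp only; linarith⟩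

/-- The two projections of pairs of nonzero vectors to the unit sphere are not homotopic. -/
theorem not_homotopic_unitFst_unitSnd {a : V} (ha : ‖a‖ = 1) {f : I × (V × V) → V}
    (hf : ContinuousOn f (Set.univ ×ˢ nonzeroPairs V))
    (hf1 : ∀ t, ∀ z ∈ nonzeroPairs V, ‖f (t, z)‖ = 1) (h0 : ∀ z, f (0, z) = unitFst z)
    (h1 : ∀ z ∈ nonzeroPairs V, f (1, z) = unitSnd z) : False := by
  let _ : MeasurableSpace V := borel V
  have : BorelSpace V := ⟨rfl⟩
  obtain ⟨ρ, hρ⟩ := exists_contDiffBump_radius_lt (a, -a) (r := 1 / 20) (by norm_num)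
  have hρs : ∀ z, ρ z ≠ 0 → ‖z - (a, -a)‖ < 1 / 20 := by
    intro z hz
    rw [← Function.mem_support, ρ.support_eq, mem_ball, dist_eq_norm] at hz
    exact hz.trans hρ
  have hg : ContinuousOn (fun p : I × (V × V) => unitSnd p.2) (Set.univ ×ˢ nonzeroPairs V) :=
    contDiffOn_unitSnd.continuousOn.comp continuousOn_snd fun p hp => hp.2
  have hg1 : ∀ (t : I), ∀ z ∈ nonzeroPairs V, ‖unitSnd ((t, z) : I × (V × V)).2‖ = 1 :=
    fun t z hz => norm_unitSnd hz
  have hf0 : ContDiffOn ℝ 2 (fun z => f (0, z)) (nonzeroPairs V) := by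
    simpa only [h0] using contDiffOn_unitFst
  -- Pairing the homotopy with the second projection would equate a positive degree with that of
  -- `(unitSnd, unitSnd)`, which is zero.
  obtain ⟨ε₁, hε₁, H₁⟩ := exists_shellDegree_shellMap_eq ha (ρ.contDiff (n := 1)) hρs hf hg hf1 hg1
    hf0 contDiffOn_unitSnd
  -- The constant homotopy compares a pair with its own smoothing.
  obtain ⟨ε₂, hε₂, H₂⟩ := exists_shellDegree_shellMap_eq ha (ρ.contDiff (n := 1)) hρs hg hg hg1 hg1
    contDiffOn_unitSnd contDiffOn_unitSnd
  obtain ⟨φ, hφ⟩ := exists_contDiffBump_radius_lt (0 : V × V) (lt_min hε₁ hε₂)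
  have e1 := H₁ φ (hφ.trans_le (min_le_left _ _))
  have e2 := H₂ φ (hφ.trans_le (min_le_right _ _))
  have heq : shellMap (fun z => f (1, z)) unitSnd = shellMap unitSnd unitSnd := by
    funext z
    by_cases hz : z ∈ nonzeroPairs V
    · simp [shellMap, h1 z hz]
    · have : shellCutoff outerProfile z = 0 :=
        image_eq_zero_of_notMem_tsupport fun h => hz (tsupport_outer_subset h)
      simp [shellMap, this]
  simp only [h0] at e1
  rw [heq] at e1
  have hpos := shellDegree_unitFst_unitSnd_pos ha ρ.continuous (fun z => ρ.nonneg)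
    ((ρ.one_of_mem_closedBall (mem_closedBall_self ρ.rIn_pos.le)).trans_ne one_ne_zero)
  have hzero := shellDegree_unitSnd_unitSnd ha hρs
  change _ = shellDegree ρ (shellMap unitFst unitSnd) at e1
  linarith

/-- In odd dimension, pairs of nonzero vectors cannot be covered by two open sets such that the
first projection to the unit sphere can be deformed to the second one over the first set, and the
second projection to the first one over the second set. -/
theorem not_cover_of_odd_finrank {a : V} (ha : ‖a‖ = 1) (hV : Odd (Module.finrank ℝ V))
    {f g : I × (V × V) → V}
    (hf : ContinuousOn f (Set.univ ×ˢ nonzeroPairs V))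
    (hg : ContinuousOn g (Set.univ ×ˢ nonzeroPairs V))
    (hf1 : ∀ t, ∀ z ∈ nonzeroPairs V, ‖f (t, z)‖ = 1)
    (hg1 : ∀ t, ∀ z ∈ nonzeroPairs V, ‖g (t, z)‖ = 1)
    (hf0 : ∀ z, f (0, z) = unitFst z) (hg0 : ∀ z, g (0, z) = unitSnd z) {O : Bool → Set (V × V)}
    (hO : ∀ i, IsOpen (O i)) (hcov : nonzeroPairs V ⊆ ⋃ i, O i)
    (hfO : ∀ z ∈ O true, f (1, z) = unitSnd z) (hgO : ∀ z ∈ O false, g (1, z) = unitFst z) :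
    False := by
  let _ : MeasurableSpace V := borel V
  have : BorelSpace V := ⟨rfl⟩
  obtain ⟨δ, hδ, hpos21⟩ := exists_shellDegree_unitSnd_unitFst_nonneg ha hV
  obtain ⟨ρ, hρ⟩ := exists_contDiffBump_radius_lt (a, -a) (r := min (1 / 20) δ)
    (lt_min (by norm_num) hδ)
  have hρs' : ∀ z, ρ z ≠ 0 → ‖z - (a, -a)‖ < min (1 / 20) δ := by
    intro z hz
    rw [← Function.mem_support, ρ.support_eq, mem_ball, dist_eq_norm] at hz
    exact hz.trans hρ
  have hρs : ∀ z, ρ z ≠ 0 → ‖z - (a, -a)‖ < 1 / 20 := fun z hz =>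
    (hρs' z hz).trans_le (min_le_left _ _)
  have hu : ContinuousOn (fun p : I × (V × V) => unitFst p.2) (Set.univ ×ˢ nonzeroPairs V) :=
    contDiffOn_unitFst.continuousOn.comp continuousOn_snd fun p hp => hp.2
  have hv : ContinuousOn (fun p : I × (V × V) => unitSnd p.2) (Set.univ ×ˢ nonzeroPairs V) :=
    contDiffOn_unitSnd.continuousOn.comp continuousOn_snd fun p hp => hp.2
  have hu1 : ∀ (t : I), ∀ z ∈ nonzeroPairs V, ‖unitFst ((t, z) : I × (V × V)).2‖ = 1 :=
    fun t z hz => norm_unitFst hz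
  have hv1 : ∀ (t : I), ∀ z ∈ nonzeroPairs V, ‖unitSnd ((t, z) : I × (V × V)).2‖ = 1 :=
    fun t z hz => norm_unitSnd hz
  have hf0' : ContDiffOn ℝ 2 (fun z => f (0, z)) (nonzeroPairs V) := by
    simpa only [hf0] using contDiffOn_unitFst
  have hg0' : ContDiffOn ℝ 2 (fun z => g (0, z)) (nonzeroPairs V) := by
    simpa only [hg0] using contDiffOn_unitSnd
  have hρc := ρ.contDiff (n := 1)
  obtain ⟨ε₁, hε₁, H₁⟩ := exists_shellDegree_shellMap_eq ha hρc hρs hf hu hf1 hu1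
    hf0' contDiffOn_unitFst
  obtain ⟨ε₂, hε₂, H₂⟩ := exists_shellDegree_shellMap_eq ha hρc hρs hf hg hf1 hg1 hf0' hg0'
  obtain ⟨ε₃, hε₃, H₃⟩ := exists_shellDegree_shellMap_eq ha hρc hρs hv hu hv1 hu1
    contDiffOn_unitSnd contDiffOn_unitFst
  obtain ⟨ε₄, hε₄, H₄⟩ := exists_shellDegree_shellMap_eq ha hρc hρs hv hg hv1 hg1
    contDiffOn_unitSnd hg0'
  -- A Lebesgue number makes the radius of local agreement uniform, as the smoothing requires.
  obtain ⟨ε, hε, Hε⟩ := lebesgue_number_lemma_of_metric (isCompact_shell (V := V) (1 / 2)) hO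
    ((shell_subset_nonzeroPairs (by norm_num)).trans hcov)
  obtain ⟨φ, hφ⟩ := exists_contDiffBump_radius_lt (0 : V × V)
    (lt_min hε (lt_min (lt_min hε₁ hε₂) (lt_min hε₃ hε₄)))
  simp only [lt_min_iff] at hφ
  obtain ⟨hφ, ⟨hφ₁, hφ₂⟩, hφ₃, hφ₄⟩ := hφ
  have hcont : ∀ {f g : I × (V × V) → V}, ContinuousOn f (Set.univ ×ˢ nonzeroPairs V) →
      ContinuousOn g (Set.univ ×ˢ nonzeroPairs V) →
      Continuous (shellMap (fun z => f (1, z)) fun z => g (1, z)) := fun hf hg =>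
    (continuous_shellMap_family hf hg).1.comp (Continuous.prodMk_right (1 : I))
  have hsum := shellDegree_alternating_sum_eq_zero (ρ := ρ) ρ.continuous (hcont hf hu)
    (hcont hf hg) (hcont hv hu) (hcont hv hg) (ε := ε) (fun z hz => by
      obtain ⟨i, hi⟩ := Hε z hz
      cases i
      · exact Or.inr fun w hw => (hgO w (hi hw)).symm
      · exact Or.inl fun w hw => hfO w (hi hw)) φ hφ
  rw [H₁ φ hφ₁, H₂ φ hφ₂, H₃ φ hφ₃, H₄ φ hφ₄] at hsum
  simp only [hf0, hg0] at hsum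
  change shellDegree ρ (shellMap unitFst unitFst) - shellDegree ρ (shellMap unitFst unitSnd) -
    shellDegree ρ (shellMap unitSnd unitFst) + shellDegree ρ (shellMap unitSnd unitSnd) = 0 at hsum
  rw [shellDegree_unitFst_unitFst ha hρs, shellDegree_unitSnd_unitSnd ha hρs] at hsum
  have h12 := shellDegree_unitFst_unitSnd_pos ha ρ.continuous (fun z => ρ.nonneg)
    ((ρ.one_of_mem_closedBall (mem_closedBall_self ρ.rIn_pos.le)).trans_ne one_ne_zero)
  have h21 := hpos21 ρ (fun z => ρ.nonneg) fun z hz => (hρs' z hz).trans_le (min_le_right _ _)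
  -- What remains is `-deg(pr₁, pr₂) - deg(pr₂, pr₁) = 0`, with a positive and a nonnegative degree.
  linarith

/-- The two projections of the product of a sphere with itself are not homotopic. -/
theorem sphere_fst_snd_not_homotopic [Nontrivial V]
    {h : I × (sphere (0 : V) 1 × sphere (0 : V) 1) → sphere (0 : V) 1} (hh : Continuous h)
    (h0 : ∀ u, h (0, u) = u.1) (h1 : ∀ u, h (1, u) = u.2) : False := by
  obtain ⟨a, ha⟩ := exists_norm_eq V zero_le_one
  refine not_homotopic_unitFst_unitSnd ha (continuousOn_extendPairs hh unitFst)
    (fun t z hz => ?_) (fun z => ?_) (fun z hz => ?_)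
  · rw [extendPairs_of_mem h _ t hz]
    simp
  · by_cases hz : z ∈ nonzeroPairs V
    · rw [extendPairs_of_mem h _ 0 hz, h0]
      rfl
    · simp [extendPairs, hz]
  · rw [extendPairs_of_mem h _ 1 hz, h1]
    rfl

theorem sphere_not_cover_of_odd_finrank [Nontrivial V] (hV : Odd (Module.finrank ℝ V))
    {f g : I × (sphere (0 : V) 1 × sphere (0 : V) 1) → sphere (0 : V) 1} (hf : Continuous f)
    (hg : Continuous g) (hf0 : ∀ u, f (0, u) = u.1) (hg0 : ∀ u, g (0, u) = u.2)
    {O : Bool → Set (sphere (0 : V) 1 × sphere (0 : V) 1)} (hO : ∀ i, IsOpen (O i))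
    (hcov : ⋃ i, O i = Set.univ) (hfO : ∀ u ∈ O true, f (1, u) = u.2)
    (hgO : ∀ u ∈ O false, g (1, u) = u.1) : False := by
  obtain ⟨a, ha⟩ := exists_norm_eq V zero_le_one
  refine not_cover_of_odd_finrank ha hV (continuousOn_extendPairs hf unitFst)
    (continuousOn_extendPairs hg unitSnd) (fun t z hz => ?_) (fun t z hz => ?_) (fun z => ?_)
    (fun z => ?_) (O := fun i => Subtype.val '' (normalizePair ⁻¹' O i)) (fun i => ?_)
    (fun z hz => ?_) ?_ ?_
  · rw [extendPairs_of_mem f _ t hz]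
    simp
  · rw [extendPairs_of_mem g _ t hz]
    simp
  · by_cases hz : z ∈ nonzeroPairs V
    · rw [extendPairs_of_mem f _ 0 hz, hf0]
      rfl
    · simp [extendPairs, hz]
  · by_cases hz : z ∈ nonzeroPairs V
    · rw [extendPairs_of_mem g _ 0 hz, hg0]
      rfl
    · simp [extendPairs, hz]
  · exact isOpen_nonzeroPairs.isOpenMap_subtype_val _
      ((hO i).preimage continuous_normalizePair)
  · obtain ⟨i, hi⟩ := Set.mem_iUnion.1 (hcov ▸ Set.mem_univ (normalizePair ⟨z, hz⟩))
    exact Set.mem_iUnion.2 ⟨i, ⟨z, hz⟩, hi, rfl⟩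
  · rintro _ ⟨z, hz, rfl⟩
    rw [extendPairs_of_mem f _ 1 z.2, hfO _ hz]
    rfl
  · rintro _ ⟨z, hz, rfl⟩
    rw [extendPairs_of_mem g _ 1 z.2, hgO _ hz]
    rfl

end Obstruction

/-! ### Lower bounds for ordinary motion planners on spheres. -/

section MotionPlanner

open Metric Topology

/-- A motion planner over `U`, that is a homotopy over `U` between the two projections. -/
def HasMotionPlanner (X : Type*) [TopologicalSpace X] (U : Set (X × X)) : Prop :=
  ∃ H : U × I → X, Continuous H ∧ ∀ u : U, H (u, 0) = (u : X × X).1 ∧ H (u, 1) = (u : X × X).2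

theorem HasEquivariantMotionPlanner.hasMotionPlanner {G : Type*} [Group G] {X : Type*}
    [TopologicalSpace X] [MulAction G X] [ContinuousConstSMul G X] {U : Set (X × X)}
    (h : HasEquivariantMotionPlanner G X U) : HasMotionPlanner X U := by
  obtain ⟨-, s, hs, -⟩ := h
  refine ⟨fun p => s p.1 p.2, by fun_prop, fun u => ?_⟩
  have := hs u
  rw [Prod.ext_iff] at this
  exact this

/-- Equivariant motion planners restrict to motion planners on the fixed point set. -/
theorem HasEquivariantMotionPlanner.hasMotionPlanner_fixedPoints {G : Type*} [Group G] {X : Type*}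
    [TopologicalSpace X] [MulAction G X] [ContinuousConstSMul G X] {U : Set (X × X)}
    (h : HasEquivariantMotionPlanner G X U) {Z : Type*} [TopologicalSpace Z] {j : Z → X}
    (hj : IsEmbedding j) (hjr : Set.range j = MulAction.fixedPoints G X) :
    HasMotionPlanner Z (Prod.map j j ⁻¹' U) := by
  obtain ⟨hU, s, hs, hG⟩ := h
  have hfix : ∀ (g : G) (z : Z), g • j z = j z := fun g z =>
    (hjr ▸ Set.mem_range_self z : j z ∈ MulAction.fixedPoints G X) g
  let e : (Prod.map j j ⁻¹' U) → U := fun u => ⟨Prod.map j j u, u.2⟩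
  have he : Continuous e :=
    ((hj.continuous.prodMap hj.continuous).comp continuous_subtype_val).subtype_mk _
  have hmem : ∀ u t, s (e u) t ∈ Set.range j := by
    intro u t
    rw [hjr]
    intro g
    -- The pair is fixed, so by equivariance its path is fixed by `g` at every time.
    have h1 : g • (e u : X × X) = e u := by
      ext <;> simp [e, hfix]
    have h2 := hG g (e u)
    have h3 : (⟨g • (e u : X × X), hU g (e u) (e u).2⟩ : U) = e u := Subtype.ext h1
    rw [h3] at h2
    exact (congrArg (fun γ : C(I, X) => γ t) h2).symm
  choose H hH using hmem
  refine ⟨fun p => H p.1 p.2, ?_, fun u => ?_⟩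
  · rw [hj.continuous_iff]
    have : Continuous fun p : (Prod.map j j ⁻¹' U) × I => s (e p.1) p.2 := by fun_prop
    convert! this using 1
    funext p
    exact hH p.1 p.2
  · have := hs (e u)
    rw [Prod.ext_iff] at this
    exact ⟨hj.injective ((hH u 0).trans this.1), hj.injective ((hH u 1).trans this.2)⟩

open Classical in
/-- A homotopy defined over an open set can be cut off by a function supported in this set. -/
theorem exists_continuous_cutoff_homotopy {X Y : Type*} [TopologicalSpace X] [TopologicalSpace Y]
    {U W : Set Y} (hU : IsOpen U) (hW : IsOpen W) (hUW : Uᶜ ⊆ W) {e₀ e₁ : Y → X}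
    (he : Continuous e₀) {H : U × I → X} (hH : Continuous H) (h0 : ∀ u, H (u, 0) = e₀ u)
    (h1 : ∀ u, H (u, 1) = e₁ u) {ψ : Y → I} (hψ : Continuous ψ) (hψW : ∀ w ∈ W, ψ w = 0) :
    ∃ h : I × Y → X, Continuous h ∧ (∀ y, h (0, y) = e₀ y) ∧ ∀ y, ψ y = 1 → h (1, y) = e₁ y := by
  -- Scaling time by `ψ` freezes the homotopy at `e₀` on `W`, where the two branches glue.
  let h : I × Y → X := fun p => if hp : p.2 ∈ U then H (⟨p.2, hp⟩, p.1 * ψ p.2) else e₀ p.2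
  have hin : ∀ t y (hy : y ∈ U), h (t, y) = H (⟨y, hy⟩, t * ψ y) := fun t y hy => by simp [h, hy]
  have hout : ∀ t y, y ∉ U → h (t, y) = e₀ y := fun t y hy => by simp [h, hy]
  have hWe : ∀ t, ∀ y ∈ W, h (t, y) = e₀ y := by
    intro t y hy
    by_cases hyU : y ∈ U
    · rw [hin t y hyU, hψW y hy, mul_zero, h0]
    · exact hout t y hyU
  refine ⟨h, continuous_iff_continuousAt.2 fun ⟨t, y⟩ => ?_, fun y => ?_, fun y hy => ?_⟩
  · by_cases hy : y ∈ U
    · refine ContinuousOn.continuousAt (s := Set.univ ×ˢ U) ?_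
        ((isOpen_univ.prod hU).mem_nhds ⟨trivial, hy⟩)
      rw [continuousOn_iff_continuous_domRestrict]
      have hc : Continuous fun p : (Set.univ ×ˢ U : Set (I × Y)) =>
          H (⟨p.1.2, p.2.2⟩, p.1.1 * ψ p.1.2) := by fun_prop
      convert! hc using 1
      funext p
      exact hin p.1.1 p.1.2 p.2.2
    · refine (he.comp continuous_snd).continuousAt.congr ?_
      filter_upwards [(isOpen_univ.prod hW).mem_nhds ⟨trivial, hUW hy⟩] with p hp
      exact (hWe p.1 p.2 hp.2).symm
  · by_cases hy : y ∈ U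
    · rw [hin 0 y hy, zero_mul, h0]
    · exact hout 0 y hy
  · have hyU : y ∈ U := by
      by_contra hyU
      exact zero_ne_one ((hψW y (hUW hyU)).symm.trans hy)
    rw [hin 1 y hyU, hy, one_mul, h1]

variable {V : Type*} [NormedAddCommGroup V] [InnerProductSpace ℝ V] [FiniteDimensional ℝ V]
  [Nontrivial V]

theorem not_hasMotionPlanner_univ_sphere :
    ¬ HasMotionPlanner (sphere (0 : V) 1) Set.univ := by
  rintro ⟨H, hH, h⟩
  exact sphere_fst_snd_not_homotopic (h := fun p => H (⟨p.2, trivial⟩, p.1)) (by fun_prop)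
    (fun u => (h ⟨u, trivial⟩).1) (fun u => (h ⟨u, trivial⟩).2)

theorem not_hasMotionPlanner_cover_sphere (hV : Odd (Module.finrank ℝ V))
    {U₁ U₂ : Set (sphere (0 : V) 1 × sphere (0 : V) 1)} (hU₁ : IsOpen U₁) (hU₂ : IsOpen U₂)
    (hcov : U₁ ∪ U₂ = Set.univ) (h₁ : HasMotionPlanner _ U₁) (h₂ : HasMotionPlanner _ U₂) :
    False := by
  obtain ⟨H₁, hH₁, e₁⟩ := h₁
  obtain ⟨H₂, hH₂, e₂⟩ := h₂
  have hdisj : Disjoint U₁ᶜ U₂ᶜ := by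
    rw [Set.disjoint_compl_left_iff_subset, Set.compl_subset_iff_union, Set.union_comm]
    exact hcov
  obtain ⟨φ, hφ0, hφ1, -⟩ :=
    exists_continuous_zero_one_of_isClosed hU₁.isClosed_compl hU₂.isClosed_compl hdisj
  let c : ℝ → I := Set.projIcc 0 1 zero_le_one
  have hc : Continuous c := continuous_projIcc
  have hc0 : ∀ r ≤ 0, c r = 0 := fun r hr => Set.projIcc_of_le_left _ hr
  have hc1 : ∀ r, 1 ≤ r → c r = 1 := fun r hr => Set.projIcc_of_right_le _ hr
  -- The Urysohn function `φ` is `0` off `U₁` and `1` off `U₂`. The deformation `f` is frozen for `φ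
  -- < 1/5` and complete for `φ ≥ 2/5`; `g`, using the second planner backwards, is frozen for `φ >
  -- 4/5` and complete for `φ ≤ 3/5`. The regions of completion overlap and cover.
  obtain ⟨f, hf, hf0, hf1⟩ := exists_continuous_cutoff_homotopy (U := U₁) (W := {u | φ u < 1 / 5})
    (e₀ := Prod.fst) (e₁ := Prod.snd) (ψ := fun u => c (5 * φ u - 1)) hU₁
    (isOpen_lt (by fun_prop) continuous_const)
    (fun u hu => by rw [Set.mem_ofPred_eq, hφ0 hu]; norm_num) continuous_fst hH₁
    (fun u => (e₁ u).1) (fun u => (e₁ u).2) (by fun_prop)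
    (fun u hu => hc0 _ (by rw [Set.mem_ofPred_eq] at hu; linarith))
  obtain ⟨g, hg, hg0, hg1⟩ := exists_continuous_cutoff_homotopy (U := U₂) (W := {u | 4 / 5 < φ u})
    (e₀ := Prod.snd) (e₁ := Prod.fst) (ψ := fun u => c (4 - 5 * φ u)) hU₂
    (isOpen_lt continuous_const (by fun_prop))
    (fun u hu => by rw [Set.mem_ofPred_eq, hφ1 hu]; norm_num) continuous_snd
    (H := fun p => H₂ (p.1, unitInterval.symm p.2)) (by fun_prop)
    (fun u => by simpa using (e₂ u).2) (fun u => by simpa using (e₂ u).1) (by fun_prop)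
    (fun u hu => hc0 _ (by rw [Set.mem_ofPred_eq] at hu; linarith))
  refine sphere_not_cover_of_odd_finrank hV hf hg hf0 hg0
    (O := fun i => if i then {u | 2 / 5 < φ u} else {u | φ u < 3 / 5}) (fun i => ?_) ?_ ?_ ?_
  · cases i
    · simpa using isOpen_lt (by fun_prop) continuous_const
    · simpa using isOpen_lt continuous_const (by fun_prop)
  · refine Set.eq_univ_of_forall fun u => Set.mem_iUnion.2 ?_
    rcases lt_or_ge (2 / 5) (φ u) with h | h
    · exact ⟨true, by simpa using h⟩
    · exact ⟨false, by simpa using h.trans_lt (by norm_num)⟩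
  · intro u hu
    refine hf1 u (hc1 _ ?_)
    simp only [if_true, Set.mem_ofPred_eq] at hu
    linarith
  · intro u hu
    refine hg1 u (hc1 _ ?_)
    simp only [Bool.false_eq_true, if_false, Set.mem_ofPred_eq] at hu
    linarith

theorem two_le_of_hasMotionPlanner_cover {m : ℕ} (hm : 1 ≤ m)
    {U : Fin m → Set (sphere (0 : V) 1 × sphere (0 : V) 1)} (hcov : ⋃ i, U i = Set.univ)
    (h : ∀ i, HasMotionPlanner _ (U i)) : 2 ≤ m := by
  by_contra hlt
  obtain rfl : m = 1 := by omega
  have h0 := h 0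
  rw [Set.iUnion_eq_const (fun i => by rw [Subsingleton.elim i 0] : ∀ i, U i = U 0)] at hcov
  rw [hcov] at h0
  exact not_hasMotionPlanner_univ_sphere h0

theorem three_le_of_hasMotionPlanner_cover (hV : Odd (Module.finrank ℝ V)) {m : ℕ} (hm : 1 ≤ m)
    {U : Fin m → Set (sphere (0 : V) 1 × sphere (0 : V) 1)} (hU : ∀ i, IsOpen (U i))
    (hcov : ⋃ i, U i = Set.univ) (h : ∀ i, HasMotionPlanner _ (U i)) : 3 ≤ m := by
  have h2 := two_le_of_hasMotionPlanner_cover hm hcov h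
  by_contra hlt
  obtain rfl : m = 2 := by omega
  refine not_hasMotionPlanner_cover_sphere hV (hU 0) (hU 1) ?_ (h 0) (h 1)
  rw [← hcov]
  ext u
  simp [Fin.exists_fin_two]

end MotionPlanner

/-! ### Equivariant homotopies and planners. -/

section EquivariantHomotopy

open Metric Topology

variable {G X : Type*} [Group G] [TopologicalSpace X] [MulAction G X] {U : Set (X × X)}

/-- A map defined on an invariant set of pairs is equivariant. -/
def IsEquivariantOn (hU : ∀ g : G, ∀ u ∈ U, g • u ∈ U) (e : U → X) : Prop :=
  ∀ (g : G) (u : U), e ⟨g • (u : X × X), hU g u u.2⟩ = g • e u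

/-- Two maps defined on an invariant set of pairs are homotopic by an equivariant homotopy. -/
def EquivariantlyHomotopic (hU : ∀ g : G, ∀ u ∈ U, g • u ∈ U) (e₀ e₁ : C(U, X)) : Prop :=
  ∃ F : e₀.Homotopy e₁, ∀ t, IsEquivariantOn hU fun u => F (t, u)

theorem EquivariantlyHomotopic.trans {hU : ∀ g : G, ∀ u ∈ U, g • u ∈ U} {e₀ e₁ e₂ : C(U, X)}
    (h₁ : EquivariantlyHomotopic hU e₀ e₁) (h₂ : EquivariantlyHomotopic hU e₁ e₂) :
    EquivariantlyHomotopic hU e₀ e₂ := by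
  obtain ⟨F₁, hF₁⟩ := h₁
  obtain ⟨F₂, hF₂⟩ := h₂
  refine ⟨F₁.trans F₂, fun t g u => ?_⟩
  dsimp only
  rw [ContinuousMap.Homotopy.trans_apply, ContinuousMap.Homotopy.trans_apply]
  split_ifs with h
  · exact hF₁ _ g u
  · exact hF₂ _ g u

/-- The first projection. -/
def pairFst (U : Set (X × X)) : C(U, X) := ⟨fun u => (u : X × X).1, by fun_prop⟩

/-- The second projection. -/
def pairSnd (U : Set (X × X)) : C(U, X) := ⟨fun u => (u : X × X).2, by fun_prop⟩

theorem isEquivariantOn_pairFst (hU : ∀ g : G, ∀ u ∈ U, g • u ∈ U) :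
    IsEquivariantOn hU (pairFst U) := fun _ _ => rfl

theorem isEquivariantOn_pairSnd (hU : ∀ g : G, ∀ u ∈ U, g • u ∈ U) :
    IsEquivariantOn hU (pairSnd U) := fun _ _ => rfl

theorem EquivariantlyHomotopic.hasEquivariantMotionPlanner [ContinuousConstSMul G X]
    {hU : ∀ g : G, ∀ u ∈ U, g • u ∈ U}
    (h : EquivariantlyHomotopic hU (pairFst U) (pairSnd U)) : HasEquivariantMotionPlanner G X U := by
  obtain ⟨F, hF⟩ := h
  let H : C(U × I, X) := ⟨fun p => F (p.2, p.1), by fun_prop⟩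
  refine ⟨hU, H.curry, fun u => ?_, fun g u => ?_⟩
  · exact Prod.ext (F.apply_zero u) (F.apply_one u)
  · ext t
    exact hF t g u

end EquivariantHomotopy

/-! ### Upper bounds for linear actions on spheres. -/

section LinearSphere

open Metric Topology

variable {G V : Type*} [Group G] [NormedAddCommGroup V] [InnerProductSpace ℝ V]
  [MulAction G (sphere (0 : V) 1)] {L : G → V →ₗ[ℝ] V}

theorem norm_linear_of_sphere_action
    (hL : ∀ (g : G) (x : sphere (0 : V) 1), ((g • x : sphere (0 : V) 1) : V) = L g x) (g : G)
    (w : V) : ‖L g w‖ = ‖w‖ := by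
  by_cases hw : w = 0
  · simp [hw]
  have hw' := norm_ne_zero_iff.2 hw
  let x : sphere (0 : V) 1 := ⟨‖w‖⁻¹ • w, by simp [norm_smul, hw']⟩
  have h1 : ‖L g x‖ = 1 := by rw [← hL]; simp
  have h2 : w = ‖w‖ • (x : V) := by simp [x, smul_smul, hw']
  rw [h2, map_smul, norm_smul, norm_smul, h1]
  simp

theorem inner_linear_of_sphere_action
    (hL : ∀ (g : G) (x : sphere (0 : V) 1), ((g • x : sphere (0 : V) 1) : V) = L g x) (g : G)
    (v w : V) : inner ℝ (L g v) (L g w) = inner ℝ v w :=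
  (⟨L g, norm_linear_of_sphere_action hL g⟩ : V →ₗᵢ[ℝ] V).inner_map_map v w

theorem coe_smul_neg_sphere
    (hL : ∀ (g : G) (x : sphere (0 : V) 1), ((g • x : sphere (0 : V) 1) : V) = L g x) (g : G)
    (x : sphere (0 : V) 1) : g • (-x) = -(g • x) := by
  ext1
  simp [hL]

variable {U : Set (sphere (0 : V) 1 × sphere (0 : V) 1)}

/-- The normalization of a nowhere vanishing map. -/
noncomputable def normalizeMap {Y : Type*} [TopologicalSpace Y] (w : C(Y, V))
    (hw : ∀ y, w y ≠ 0) : C(Y, sphere (0 : V) 1) where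
  toFun y := ⟨‖w y‖⁻¹ • w y, by simp [norm_smul, hw y]⟩
  continuous_toFun := by
    refine Continuous.subtype_mk (Continuous.smul (Continuous.inv₀ ?_ ?_) ?_) _
    · fun_prop
    · exact fun y => norm_ne_zero_iff.2 (hw y)
    · fun_prop

theorem isEquivariantOn_normalizeMap
    (hL : ∀ (g : G) (x : sphere (0 : V) 1), ((g • x : sphere (0 : V) 1) : V) = L g x)
    (hU : ∀ g : G, ∀ u ∈ U, g • u ∈ U) {w : C(U, V)} (hw : ∀ y, w y ≠ 0)
    (h : ∀ (g : G) (u : U), w ⟨g • (u : sphere (0 : V) 1 × sphere (0 : V) 1), hU g u u.2⟩ =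
      L g (w u)) : IsEquivariantOn hU (normalizeMap w hw) := by
  intro g u
  ext1
  rw [hL]
  simp [normalizeMap, h, norm_linear_of_sphere_action hL]

theorem line_ne_zero {a b : sphere (0 : V) 1} (hab : a ≠ -b) (t : I) :
    (1 - t : ℝ) • (a : V) + (t : ℝ) • (b : V) ≠ 0 := by
  intro h
  have ha : ‖(a : V)‖ = 1 := by simp
  have hb : ‖(b : V)‖ = 1 := by simp
  have h1 : (1 - t : ℝ) • (a : V) = -((t : ℝ) • (b : V)) := eq_neg_of_add_eq_zero_left h
  have h2 := congrArg norm h1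
  rw [norm_neg, norm_smul, norm_smul, ha, hb, mul_one, mul_one, Real.norm_of_nonneg t.2.1,
    Real.norm_of_nonneg (sub_nonneg.2 t.2.2)] at h2
  rw [h2, ← smul_neg] at h1
  have ht : (t : ℝ) ≠ 0 := by
    intro h0
    rw [h0] at h2
    norm_num at h2
  exact hab (Subtype.ext (smul_right_injective V ht h1))

/-- The segment between non-antipodal unit vectors avoids the origin, and normalizing it commutes
with linear isometries. -/
theorem equivariantlyHomotopic_of_ne_neg
    (hL : ∀ (g : G) (x : sphere (0 : V) 1), ((g • x : sphere (0 : V) 1) : V) = L g x)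
    {hU : ∀ g : G, ∀ u ∈ U, g • u ∈ U} {e₀ e₁ : C(U, sphere (0 : V) 1)}
    (h₀ : IsEquivariantOn hU e₀) (h₁ : IsEquivariantOn hU e₁) (h : ∀ u, e₀ u ≠ -e₁ u) :
    EquivariantlyHomotopic hU e₀ e₁ := by
  let w : C(I × U, V) := ⟨fun p => (1 - p.1 : ℝ) • (e₀ p.2 : V) + (p.1 : ℝ) • (e₁ p.2 : V), by
    fun_prop⟩
  have hw : ∀ p, w p ≠ 0 := fun p => line_ne_zero (h p.2) p.1
  refine ⟨⟨normalizeMap w hw, fun u => ?_, fun u => ?_⟩, fun t g u => ?_⟩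
  · ext1
    simp [normalizeMap, w]
  · ext1
    simp [normalizeMap, w]
  · have e : w (t, ⟨g • (u : sphere (0 : V) 1 × sphere (0 : V) 1), hU g u u.2⟩) =
        L g (w (t, u)) := by
      simp [w, h₀ g u, h₁ g u, hL]
    ext1
    rw [hL]
    change ‖w _‖⁻¹ • w _ = L g (‖w _‖⁻¹ • w _)
    rw [e, norm_linear_of_sphere_action hL, map_smul]

theorem ne_neg_of_inner_eq_zero {a b : sphere (0 : V) 1} (h : inner ℝ (a : V) (b : V) = 0) :
    a ≠ -b := by
  rintro rfl
  simp at h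

variable [ContinuousConstSMul G (sphere (0 : V) 1)]

/-- The route runs from `x` to the direction of `v x`, then to `-x`, then to `y`. Orthogonality
excludes antipodes in the first two legs, and `x ≠ y` in the last. -/
theorem hasEquivariantMotionPlanner_of_equivariantField
    (hL : ∀ (g : G) (x : sphere (0 : V) 1), ((g • x : sphere (0 : V) 1) : V) = L g x)
    (hU : ∀ g : G, ∀ u ∈ U, g • u ∈ U) (hne : ∀ u ∈ U, u.1 ≠ u.2) {v : sphere (0 : V) 1 → V}
    (hv : Continuous v) (hv0 : ∀ u ∈ U, v u.1 ≠ 0) (hvx : ∀ x : sphere (0 : V) 1, inner ℝ (x : V) (v x) = 0)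
    (hvL : ∀ (g : G) x, v (g • x) = L g (v x)) :
    HasEquivariantMotionPlanner G (sphere (0 : V) 1) U := by
  let w : C(U, V) := ⟨fun u => v (u : sphere (0 : V) 1 × sphere (0 : V) 1).1, by fun_prop⟩
  have hw : ∀ u, w u ≠ 0 := fun u => hv0 u u.2
  have hv := isEquivariantOn_normalizeMap hL hU hw fun g u => hvL g _
  let nf : C(U, sphere (0 : V) 1) := ⟨fun u => -pairFst U u, by fun_prop⟩
  have hn : IsEquivariantOn hU nf := fun g u => (coe_smul_neg_sphere hL g _).symm
  have horth : ∀ u : U, inner ℝ (pairFst U u : V) (normalizeMap w hw u : V) = 0 := fun u => by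
    change inner ℝ (pairFst U u : V) (‖w u‖⁻¹ • w u) = 0
    rw [inner_smul_right, show inner ℝ (pairFst U u : V) (w u) = 0 from hvx _, mul_zero]
  refine EquivariantlyHomotopic.hasEquivariantMotionPlanner (hU := hU) ?_
  refine (equivariantlyHomotopic_of_ne_neg hL (isEquivariantOn_pairFst hU) hv fun u =>
    ne_neg_of_inner_eq_zero (horth u)).trans ?_
  refine (equivariantlyHomotopic_of_ne_neg hL hv hn fun u =>
    ne_neg_of_inner_eq_zero ?_).trans ?_
  · have := horth u
    rw [real_inner_comm] at this
    change inner ℝ (normalizeMap w hw u : V) (-(pairFst U u : V)) = 0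
    rw [inner_neg_right, this, neg_zero]
  · exact equivariantlyHomotopic_of_ne_neg hL hn (isEquivariantOn_pairSnd hU) fun u =>
      fun h => hne u u.2 (neg_injective h)

theorem hasEquivariantMotionPlanner_nonantipodal
    (hL : ∀ (g : G) (x : sphere (0 : V) 1), ((g • x : sphere (0 : V) 1) : V) = L g x) :
    HasEquivariantMotionPlanner G (sphere (0 : V) 1) {u | u.1 ≠ -u.2} := by
  have hU : ∀ g : G, ∀ u ∈ {u : sphere (0 : V) 1 × sphere (0 : V) 1 | u.1 ≠ -u.2},
      g • u ∈ {u : sphere (0 : V) 1 × sphere (0 : V) 1 | u.1 ≠ -u.2} := by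
    intro g u hu h
    refine hu (MulAction.injective g ?_)
    change g • u.1 = g • (-u.2)
    rw [coe_smul_neg_sphere hL]
    exact h
  exact EquivariantlyHomotopic.hasEquivariantMotionPlanner (hU := hU)
    (equivariantlyHomotopic_of_ne_neg hL (isEquivariantOn_pairFst hU) (isEquivariantOn_pairSnd hU)
      fun u => u.2)

theorem equivariantTC_le_two [FiniteDimensional ℝ V]
    (hL : ∀ (g : G) (x : sphere (0 : V) 1), ((g • x : sphere (0 : V) 1) : V) = L g x)
    {v : V →ₗ[ℝ] V} (hvx : ∀ x, inner ℝ x (v x) = 0) (hv0 : ∀ x, v x = 0 → x = 0)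
    (hvL : ∀ g x, v (L g x) = L g (v x)) : equivariantTC G (sphere (0 : V) 1) ≤ 2 := by
  refine sInf_le ⟨2, rfl, by norm_num, ![{u | u.1 ≠ -u.2}, {u | u.1 ≠ u.2}], ?_, ?_, ?_⟩
  · simp only [Fin.forall_fin_two, Matrix.cons_val_zero, Matrix.cons_val_one]
    exact ⟨isOpen_ne_fun continuous_fst continuous_snd.neg,
      isOpen_ne_fun continuous_fst continuous_snd⟩
  · refine Set.eq_univ_of_forall fun u => Set.mem_iUnion.2 ?_
    simp only [Fin.exists_fin_two, Matrix.cons_val_zero, Matrix.cons_val_one]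
    by_cases h : u.1 = -u.2
    · right
      rw [Set.mem_ofPred_eq, h]
      exact fun h' => ne_neg_of_mem_unit_sphere ℝ u.2 h'.symm
    · exact Or.inl h
  · simp only [Fin.forall_fin_two, Matrix.cons_val_zero, Matrix.cons_val_one]
    refine ⟨hasEquivariantMotionPlanner_nonantipodal hL, ?_⟩
    have hvc := v.continuous_of_finiteDimensional
    refine hasEquivariantMotionPlanner_of_equivariantField hL
      (fun g u hu h => hu (MulAction.injective g h)) (fun u hu => hu)
      (v := fun x => v x) (by fun_prop)
      (fun u _ h => ne_zero_of_mem_unit_sphere u.1 (hv0 _ h)) (fun x => hvx _) (fun g x => ?_)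
    rw [hL, hvL]

/-- The tangential part of `e` vanishes only at `±e`. The antipodal pairs `(±e, ∓e)` left uncovered
avoid `-f` because `e` and `f` are orthogonal, and there both points can be contracted to the fixed
point `f`. -/
theorem equivariantTC_le_three
    (hL : ∀ (g : G) (x : sphere (0 : V) 1), ((g • x : sphere (0 : V) 1) : V) = L g x)
    {e f : sphere (0 : V) 1} (hef : inner ℝ (e : V) (f : V) = 0) (he : ∀ g : G, g • e = e)
    (hf : ∀ g : G, g • f = f) : equivariantTC G (sphere (0 : V) 1) ≤ 3 := by
  have hne : ∀ g : G, g • (-e) = -e := fun g => by rw [coe_smul_neg_sphere hL, he]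
  have hnf : ∀ g : G, g • (-f) = -f := fun g => by rw [coe_smul_neg_sphere hL, hf]
  refine sInf_le ⟨3, rfl, by norm_num, ![{u | u.1 ≠ -u.2},
    {u | u.1 ≠ u.2 ∧ u.1 ≠ e ∧ u.1 ≠ -e}, {u | u.1 ≠ -f ∧ u.2 ≠ -f}], ?_, ?_, ?_⟩
  · intro i
    fin_cases i
    · exact isOpen_ne_fun continuous_fst continuous_snd.neg
    · exact (isOpen_ne_fun continuous_fst continuous_snd).inter
        ((isOpen_ne_fun continuous_fst continuous_const).inter
          (isOpen_ne_fun continuous_fst continuous_const))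
    · exact (isOpen_ne_fun continuous_fst continuous_const).inter
        (isOpen_ne_fun continuous_snd continuous_const)
  · refine Set.eq_univ_of_forall fun u => Set.mem_iUnion.2 ?_
    by_cases h : u.1 = -u.2
    swap
    · exact ⟨0, h⟩
    by_cases h' : u.1 = e ∨ u.1 = -e
    · refine ⟨2, ?_⟩
      have hfe : inner ℝ (f : V) (e : V) = 0 := by rw [real_inner_comm]; exact hef
      have h1 : e ≠ -f := ne_neg_of_inner_eq_zero hef
      have h2 : -e ≠ -f := fun h => by
        have := neg_injective h
        subst this
        simp at hef
      have h3 : u.2 = -u.1 := by rw [h, neg_neg]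
      change u.1 ≠ -f ∧ u.2 ≠ -f
      rcases h' with h' | h'
      · rw [h3, h']
        exact ⟨h1, h2⟩
      · rw [h3, h', neg_neg]
        exact ⟨h2, h1⟩
    · push Not at h'
      refine ⟨1, ?_, h'⟩
      rw [h]
      exact fun h' => ne_neg_of_mem_unit_sphere ℝ u.2 h'.symm
  · intro i
    fin_cases i
    · exact hasEquivariantMotionPlanner_nonantipodal hL
    · refine hasEquivariantMotionPlanner_of_equivariantField hL (fun g u hu => ?_)
        (fun u hu => hu.1)
        (v := fun x => (e : V) - (inner ℝ (x : V) (e : V) : ℝ) • (x : V)) (by fun_prop)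
        (fun u hu h => ?_) (fun x => ?_) (fun g x => ?_)
      · exact ⟨fun h => hu.1 (MulAction.injective g h),
          fun h => hu.2.1 (MulAction.injective g (h.trans (he g).symm)),
          fun h => hu.2.2 (MulAction.injective g (h.trans (hne g).symm))⟩
      · have h1 : (e : V) = (inner ℝ (u.1 : V) (e : V) : ℝ) • (u.1 : V) :=
          sub_eq_zero.1 h
        have h2 := congrArg norm h1
        rw [norm_smul, norm_eq_of_mem_sphere, norm_eq_of_mem_sphere, mul_one, Real.norm_eq_abs] at h2
        rcases eq_or_eq_neg_of_abs_eq h2.symm with h3 | h3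
        · rw [h3, one_smul] at h1
          exact hu.2.1 (Subtype.ext h1.symm)
        · rw [h3, neg_smul, one_smul] at h1
          exact hu.2.2 (Subtype.ext (neg_eq_iff_eq_neg.1 h1.symm))
      · rw [inner_sub_right, inner_smul_right, real_inner_self_eq_norm_sq, norm_eq_of_mem_sphere]
        ring
      · have heL : L g e = e := by rw [← hL, he]
        rw [map_sub, map_smul, heL, hL]
        nth_rw 2 [← heL]
        rw [inner_linear_of_sphere_action (L := L) hL]
    · have hU : ∀ g : G, ∀ u ∈ {u : sphere (0 : V) 1 × sphere (0 : V) 1 | u.1 ≠ -f ∧ u.2 ≠ -f},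
          g • u ∈ {u : sphere (0 : V) 1 × sphere (0 : V) 1 | u.1 ≠ -f ∧ u.2 ≠ -f} := fun g u hu =>
        ⟨fun h => hu.1 (MulAction.injective g (h.trans (hnf g).symm)),
          fun h => hu.2 (MulAction.injective g (h.trans (hnf g).symm))⟩
      have hc : IsEquivariantOn hU (ContinuousMap.const _ f) := fun g u => (hf g).symm
      exact EquivariantlyHomotopic.hasEquivariantMotionPlanner (hU := hU)
        ((equivariantlyHomotopic_of_ne_neg hL (isEquivariantOn_pairFst hU) hc
          fun u => u.2.1).trans
        (equivariantlyHomotopic_of_ne_neg hL hc (isEquivariantOn_pairSnd hU)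
          fun u h => u.2.2 (neg_eq_iff_eq_neg.1 h.symm)))

end LinearSphere

/-! ### Equivariant injective skew maps. -/

section SkewField

open Module

/-- An orthonormal basis split into pairs gives orthogonal planes, each turned by a right angle. -/
theorem exists_skew_injective {F : Type*} [NormedAddCommGroup F] [InnerProductSpace ℝ F]
    [FiniteDimensional ℝ F] (hF : Even (finrank ℝ F)) :
    ∃ J : F →ₗ[ℝ] F, (∀ x, inner ℝ x (J x) = 0) ∧ ∀ x, J x = 0 → x = 0 := by
  obtain ⟨m, hm⟩ := hF
  let b : OrthonormalBasis (Fin m ⊕ Fin m) ℝ F :=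
    (stdOrthonormalBasis ℝ F).reindex ((finCongr hm).trans finSumFinEquiv.symm)
  let J : F →ₗ[ℝ] F := ∑ i : Fin m,
    ((innerₛₗ ℝ (b (Sum.inl i))).smulRight (b (Sum.inr i)) -
      (innerₛₗ ℝ (b (Sum.inr i))).smulRight (b (Sum.inl i)))
  have hJ : ∀ x, J x = ∑ i : Fin m, ((inner ℝ (b (Sum.inl i)) x : ℝ) • b (Sum.inr i) -
      (inner ℝ (b (Sum.inr i)) x : ℝ) • b (Sum.inl i)) := fun x => by
    simp [J, LinearMap.sum_apply]
  refine ⟨J, fun x => ?_, fun x hx => ?_⟩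
  · rw [hJ, inner_sum]
    refine Finset.sum_eq_zero fun i _ => ?_
    rw [inner_sub_right, inner_smul_right, inner_smul_right, real_inner_comm x (b (Sum.inr i)),
      real_inner_comm x (b (Sum.inl i))]
    ring
  · refine b.toBasis.repr.injective (Finsupp.ext fun i => ?_)
    rw [map_zero, Finsupp.zero_apply, OrthonormalBasis.coe_toBasis_repr_apply, b.repr_apply_apply]
    have hb := fun i j => (orthonormal_iff_ite.1 b.orthonormal) i j
    rcases i with i | i
    · have h := congrArg (inner ℝ (b (Sum.inr i))) hx
      simpa [hJ, inner_sum, inner_sub_right, inner_smul_right, hb] using h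
    · have h := congrArg (inner ℝ (b (Sum.inl i))) hx
      simpa [hJ, inner_sum, inner_sub_right, inner_smul_right, hb] using h

variable {V : Type*} [NormedAddCommGroup V] [InnerProductSpace ℝ V] {G : Type*}

theorem Representation.inner_left_eq_inner_inv [Group G] {ρ : Representation ℝ G V}
    (hρ : ∀ g x y, inner ℝ (ρ g x) (ρ g y) = inner ℝ x y) (g : G) (x y : V) :
    inner ℝ (ρ g x) y = inner ℝ x (ρ g⁻¹ y) := by
  rw [← hρ g x, ρ.self_inv_apply]

variable [FiniteDimensional ℝ V]

/-- If all vectors fixed by the square of some element are fixed by the group, an orthogonal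
representation of a commutative group with even dimensional fixed space commutes with an injective
skew map. -/
theorem exists_equivariant_skew_injective_of_sq_fixed [CommGroup G]
    {ρ : Representation ℝ G V} (hρ : ∀ g x y, inner ℝ (ρ g x) (ρ g y) = inner ℝ x y)
    {W : Submodule ℝ V} (hW : ∀ x, x ∈ W ↔ ∀ g, ρ g x = x) (hWe : Even (finrank ℝ W)) {s : G}
    (hs : ∀ x, ρ (s * s) x = x → ∀ g, ρ g x = x) :
    ∃ v : V →ₗ[ℝ] V, (∀ x, inner ℝ x (v x) = 0) ∧ (∀ x, v x = 0 → x = 0) ∧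
      ∀ g x, v (ρ g x) = ρ g (v x) := by
  obtain ⟨J, hJx, hJ0⟩ := exists_skew_injective hWe
  let P := W.orthogonalProjectionOnto.toLinearMap
  have hadj := Representation.inner_left_eq_inner_inv hρ
  have hPx : ∀ x (w : W), inner ℝ x (w : V) = inner ℝ (P x) w := fun x w =>
    (W.inner_orthogonalProjectionOnto_eq_of_mem_right w x).symm
  have hPρ : ∀ g x, P (ρ g x) = P x := by
    intro g x
    refine ext_inner_right ℝ fun w => ?_
    rw [← hPx, ← hPx, hadj, (hW w).1 w.2]
  -- The adjoint of `ρ s` is `ρ s⁻¹`, so `B` is skew with image orthogonal to `W`; its kernel is the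
  -- fixed space of `s²`, and it commutes with the commutative group.
  let B : V →ₗ[ℝ] V := ρ s - ρ s⁻¹
  have hB : ∀ x, B x = ρ s x - ρ s⁻¹ x := fun _ => rfl
  have hBW : ∀ x (w : W), inner ℝ (B x) (w : V) = 0 := by
    intro x w
    rw [hB, inner_sub_left, hadj, hadj, (hW w).1 w.2, (hW w).1 w.2, sub_self]
  refine ⟨W.subtype ∘ₗ J ∘ₗ P + B, fun x => ?_, fun x hx => ?_, fun g x => ?_⟩
  · change inner ℝ x ((J (P x) : V) + B x) = 0
    rw [inner_add_right, hPx, hJx, hB, inner_sub_right, ← hadj, real_inner_comm, sub_self, add_zero]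
  · change (J (P x) : V) + B x = 0 at hx
    have h1 : J (P x) = 0 := by
      rw [← inner_self_eq_zero (𝕜 := ℝ), W.coe_inner]
      have := hBW x (J (P x))
      rw [eq_neg_of_add_eq_zero_right hx, inner_neg_left, neg_eq_zero] at this
      exact this
    rw [h1, ZeroMemClass.coe_zero, zero_add, hB, sub_eq_zero] at hx
    have h2 : ρ (s * s) x = x := by
      rw [map_mul, Module.End.mul_apply, hx, ρ.self_inv_apply]
    have h3 : x ∈ W := (hW x).2 (hs x h2)
    have h4 := hJ0 _ h1
    rw [← inner_self_eq_zero (𝕜 := ℝ)]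
    have := hPx x ⟨x, h3⟩
    rwa [h4, inner_zero_left] at this
  · change (J (P (ρ g x)) : V) + B (ρ g x) = ρ g ((J (P x) : V) + B x)
    rw [hPρ, map_add, (hW _).1 (J (P x)).2, hB, hB, map_sub]
    simp only [← Module.End.mul_apply, ← map_mul, mul_comm]

/-- An orthogonal representation of a group of order two whose fixed space and its complement are
even dimensional commutes with an injective skew map. -/
theorem exists_equivariant_skew_injective_of_sq_eq_one [Group G] {ρ : Representation ℝ G V}
    (hρ : ∀ g x y, inner ℝ (ρ g x) (ρ g y) = inner ℝ x y)
    {W : Submodule ℝ V} (hW : ∀ x, x ∈ W ↔ ∀ g, ρ g x = x) (hWe : Even (finrank ℝ W))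
    (hWo : Even (finrank ℝ Wᗮ)) {s : G} (hs : s * s = 1) (hG : ∀ g, g = 1 ∨ g = s) :
    ∃ v : V →ₗ[ℝ] V, (∀ x, inner ℝ x (v x) = 0) ∧ (∀ x, v x = 0 → x = 0) ∧
      ∀ g x, v (ρ g x) = ρ g (v x) := by
  obtain ⟨J, hJx, hJ0⟩ := exists_skew_injective hWe
  obtain ⟨K, hKx, hK0⟩ := exists_skew_injective hWo
  let P := W.orthogonalProjectionOnto.toLinearMap
  let Q := Wᗮ.orthogonalProjectionOnto.toLinearMap
  have hadj := Representation.inner_left_eq_inner_inv hρ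
  have hPx : ∀ x (w : W), inner ℝ x (w : V) = inner ℝ (P x) w := fun x w =>
    (W.inner_orthogonalProjectionOnto_eq_of_mem_right w x).symm
  have hQx : ∀ x (w : Wᗮ), inner ℝ x (w : V) = inner ℝ (Q x) w := fun x w =>
    (Wᗮ.inner_orthogonalProjectionOnto_eq_of_mem_right w x).symm
  have hPQ : ∀ x, (P x : V) + Q x = x := fun x =>
    W.starProjection_add_starProjection_orthogonal x
  have hPρ : ∀ g x, P (ρ g x) = P x := by
    intro g x
    refine ext_inner_right ℝ fun w => ?_
    rw [← hPx, ← hPx, hadj, (hW w).1 w.2]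
  have hsW : ∀ x, ρ s x + x ∈ W := by
    intro x
    rw [hW]
    intro g
    rcases hG g with rfl | rfl
    · simp
    · rw [map_add, ← Module.End.mul_apply, ← map_mul, hs, map_one, Module.End.one_apply, add_comm]
  -- The sum `ρ s w + w` lies both in `W` and in its complement. Hence any skew map on `Wᗮ` is
  -- equivariant.
  have hso : ∀ w : Wᗮ, ρ s w = -(w : V) := by
    intro w
    have h1 : ρ s w + w ∈ Wᗮ := by
      rw [Submodule.mem_orthogonal']
      intro u hu
      rw [inner_add_left, hadj, (hW u).1 hu, W.inner_left_of_mem_orthogonal hu w.2, add_zero]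
    have h2 := W.inner_right_of_mem_orthogonal (hsW w) h1
    exact eq_neg_of_add_eq_zero_left (inner_self_eq_zero.1 h2)
  have hQs : ∀ x, Q (ρ s x) = - Q x := by
    intro x
    refine ext_inner_right ℝ fun w => ?_
    have h1 := W.inner_right_of_mem_orthogonal (hsW x) w.2
    rw [inner_add_left] at h1
    rw [inner_neg_left, ← hQx, ← hQx]
    linarith
  refine ⟨W.subtype ∘ₗ J ∘ₗ P + Wᗮ.subtype ∘ₗ K ∘ₗ Q, fun x => ?_, fun x hx => ?_, fun g x => ?_⟩
  · change inner ℝ x ((J (P x) : V) + K (Q x)) = 0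
    rw [inner_add_right, hPx, hJx, hQx, hKx, add_zero]
  · change (J (P x) : V) + K (Q x) = 0 at hx
    have h0 := W.inner_right_of_mem_orthogonal (J (P x)).2 (K (Q x)).2
    have h1 : J (P x) = 0 := by
      rw [← inner_self_eq_zero (𝕜 := ℝ), W.coe_inner]
      rwa [eq_neg_of_add_eq_zero_right hx, inner_neg_right, neg_eq_zero] at h0
    have h2 : K (Q x) = 0 := by
      rw [h1, ZeroMemClass.coe_zero, zero_add] at hx
      exact Subtype.ext hx
    rw [← hPQ x, hJ0 _ h1, hK0 _ h2]
    simp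
  · change (J (P (ρ g x)) : V) + K (Q (ρ g x)) = ρ g ((J (P x) : V) + K (Q x))
    rw [hPρ, map_add, (hW _).1 (J (P x)).2]
    rcases hG g with rfl | rfl
    · simp
    · rw [hQs, hso, map_neg]
      rfl

end SkewField

/-! ### Representations, fixed subspheres and the final bounds. -/

section Assembly

open Module Metric

/-- The orthogonal representation which extends a linear action on the unit sphere. -/
theorem exists_representation_of_sphere_action {G V : Type*} [Group G] [NormedAddCommGroup V]
    [InnerProductSpace ℝ V] [MulAction G (sphere (0 : V) 1)]
    (hlin : ∀ g : G, ∃ L : V →ₗ[ℝ] V, ∀ x : sphere (0 : V) 1,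
      ((g • x : sphere (0 : V) 1) : V) = L x) :
    ∃ ρ : Representation ℝ G V, ∀ (g : G) (x : sphere (0 : V) 1),
      ((g • x : sphere (0 : V) 1) : V) = ρ g x := by
  choose L hL using hlin
  have hext : ∀ A B : V →ₗ[ℝ] V, (∀ x : sphere (0 : V) 1, A x = B x) → A = B := by
    intro A B h
    refine LinearMap.ext fun w => ?_
    by_cases hw : w = 0
    · simp [hw]
    have hw' := norm_ne_zero_iff.2 hw
    have h1 := h ⟨‖w‖⁻¹ • w, by simp [norm_smul, hw']⟩
    simp only [map_smul] at h1
    exact smul_right_injective V (inv_ne_zero hw') h1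
  refine ⟨⟨⟨L, hext _ _ fun x => ?_⟩, fun g h => hext _ _ fun x => ?_⟩, hL⟩
  · rw [← hL, one_smul]
    rfl
  · rw [← hL, mul_smul, hL, hL]
    rfl

theorem mem_iff_fixed_of_sphere_action {G V : Type*} [Group G] [NormedAddCommGroup V]
    [InnerProductSpace ℝ V] [MulAction G (sphere (0 : V) 1)] {ρ : Representation ℝ G V}
    (hL : ∀ (g : G) (x : sphere (0 : V) 1), ((g • x : sphere (0 : V) 1) : V) = ρ g x)
    {W : Submodule ℝ V}
    (hW : MulAction.fixedPoints G (sphere (0 : V) 1) = {x : sphere (0 : V) 1 | (x : V) ∈ W})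
    (w : V) : w ∈ W ↔ ∀ g, ρ g w = w := by
  by_cases hw : w = 0
  · simp [hw]
  have hw' := norm_ne_zero_iff.2 hw
  let x : sphere (0 : V) 1 := ⟨‖w‖⁻¹ • w, by simp [norm_smul, hw']⟩
  have h1 : x ∈ MulAction.fixedPoints G (sphere (0 : V) 1) ↔ (x : V) ∈ W := by
    rw [hW]
    rfl
  rw [← W.smul_mem_iff (inv_ne_zero hw')]
  refine h1.symm.trans (forall_congr' fun g => ?_)
  rw [Subtype.ext_iff, hL]
  change ρ g (‖w‖⁻¹ • w) = ‖w‖⁻¹ • w ↔ _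
  rw [map_smul]
  exact (smul_right_injective V (inv_ne_zero hw')).eq_iff

/-- The inclusion of the unit sphere of a subspace. -/
def subsphereInclusion {V : Type*} [NormedAddCommGroup V] [InnerProductSpace ℝ V]
    (W : Submodule ℝ V) (x : sphere (0 : W) 1) : sphere (0 : V) 1 :=
  ⟨((x : W) : V), mem_sphere_zero_iff_norm.2 (norm_eq_of_mem_sphere x)⟩

theorem isEmbedding_subsphereInclusion {V : Type*} [NormedAddCommGroup V] [InnerProductSpace ℝ V]
    (W : Submodule ℝ V) : Topology.IsEmbedding (subsphereInclusion W) :=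
  Topology.IsEmbedding.of_comp (by unfold subsphereInclusion; fun_prop) continuous_subtype_val
    (Topology.IsEmbedding.subtypeVal.comp Topology.IsEmbedding.subtypeVal :
      Topology.IsEmbedding fun x : sphere (0 : W) 1 => ((x : W) : V))

theorem range_subsphereInclusion {V : Type*} [NormedAddCommGroup V] [InnerProductSpace ℝ V]
    (W : Submodule ℝ V) :
    Set.range (subsphereInclusion W) = {x : sphere (0 : V) 1 | (x : V) ∈ W} := by
  ext x
  constructor
  · rintro ⟨y, rfl⟩
    exact (y : W).2
  · intro hx
    exact ⟨⟨⟨x, hx⟩, mem_sphere_zero_iff_norm.2 (norm_eq_of_mem_sphere x)⟩, rfl⟩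

variable {G V : Type*} [Group G] [NormedAddCommGroup V] [InnerProductSpace ℝ V]
  [FiniteDimensional ℝ V] [MulAction G (sphere (0 : V) 1)]
  [ContinuousConstSMul G (sphere (0 : V) 1)]

theorem two_le_equivariantTC_sphere [Nontrivial V] : 2 ≤ equivariantTC G (sphere (0 : V) 1) := by
  refine le_sInf ?_
  rintro _ ⟨m, rfl, hm, U, -, hcov, h⟩
  exact_mod_cast two_le_of_hasMotionPlanner_cover hm hcov fun i => (h i).hasMotionPlanner

theorem three_le_equivariantTC_sphere [Nontrivial V] (hV : Odd (finrank ℝ V)) :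
    3 ≤ equivariantTC G (sphere (0 : V) 1) := by
  refine le_sInf ?_
  rintro _ ⟨m, rfl, hm, U, hU, hcov, h⟩
  exact_mod_cast three_le_of_hasMotionPlanner_cover hV hm hU hcov fun i => (h i).hasMotionPlanner

theorem three_le_equivariantTC_sphere_of_fixedPoints {W : Submodule ℝ V}
    (hW : MulAction.fixedPoints G (sphere (0 : V) 1) = {x : sphere (0 : V) 1 | (x : V) ∈ W})
    (hWo : Odd (finrank ℝ W)) : 3 ≤ equivariantTC G (sphere (0 : V) 1) := by
  have : Nontrivial W := Module.nontrivial_of_finrank_pos (R := ℝ) hWo.pos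
  have hj := isEmbedding_subsphereInclusion W
  refine le_sInf ?_
  rintro _ ⟨m, rfl, hm, U, hU, hcov, h⟩
  have hp : ∀ i, HasMotionPlanner (sphere (0 : W) 1)
      (Prod.map (subsphereInclusion W) (subsphereInclusion W) ⁻¹' U i) := fun i =>
    (h i).hasMotionPlanner_fixedPoints hj ((range_subsphereInclusion W).trans hW.symm)
  refine Nat.cast_le.2 (three_le_of_hasMotionPlanner_cover hWo hm
    (fun i => (hU i).preimage (hj.continuous.prodMap hj.continuous)) ?_ hp)
  rw [← Set.preimage_iUnion, hcov, Set.preimage_univ]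

theorem multiplicative_zmod_two_ofAdd_one :
    (Multiplicative.ofAdd 1 * Multiplicative.ofAdd 1 : Multiplicative (ZMod 2)) = 1 ∧
      ∀ g : Multiplicative (ZMod 2), g = 1 ∨ g = Multiplicative.ofAdd 1 := by
  decide

theorem exists_equivariant_skew_injective_zmod {p : ℕ} [Fact p.Prime]
    {ρ : Representation ℝ (Multiplicative (ZMod p)) V}
    (hρ : ∀ g x y, inner ℝ (ρ g x) (ρ g y) = inner ℝ x y)
    {W : Submodule ℝ V} (hW : ∀ x, x ∈ W ↔ ∀ g, ρ g x = x) (hWe : Even (finrank ℝ W))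
    (hV : Even (finrank ℝ V)) :
    ∃ v : V →ₗ[ℝ] V, (∀ x, inner ℝ x (v x) = 0) ∧ (∀ x, v x = 0 → x = 0) ∧
      ∀ g x, v (ρ g x) = ρ g (v x) := by
  have hp : p.Prime := Fact.out
  rcases hp.eq_two_or_odd' with rfl | hodd
  · refine exists_equivariant_skew_injective_of_sq_eq_one hρ hW hWe ?_
      multiplicative_zmod_two_ofAdd_one.1 multiplicative_zmod_two_ofAdd_one.2
    have := W.finrank_add_finrank_orthogonal
    rw [← this, Nat.even_add] at hV
    exact hV.1 hWe
  · refine exists_equivariant_skew_injective_of_sq_fixed hρ hW hWe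
      (s := Multiplicative.ofAdd 1) fun x hx g => ?_
    obtain ⟨m, hm⟩ := hodd
    have hpow : ∀ k : ℕ, ρ ((Multiplicative.ofAdd 1 * Multiplicative.ofAdd 1) ^ k) x = x := by
      intro k
      induction k with
      | zero => simp
      | succ k ih => rw [pow_succ, map_mul, Module.End.mul_apply, hx, ih]
    -- For `p = 2m + 1` the inverse of `2` is `m + 1`, so the square of the generator still
    -- generates.
    have hg : g = (Multiplicative.ofAdd (1 : ZMod p) * Multiplicative.ofAdd 1) ^
        ((m + 1) * (Multiplicative.toAdd g).val) := by
      apply Multiplicative.toAdd.injective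
      have h2 : (2 * (m + 1) : ZMod p) = 1 := by
        have : ((2 * m + 1 : ℕ) : ZMod p) = 0 := by rw [← hm]; simp
        push_cast at this
        linear_combination this
      rw [toAdd_pow, toAdd_mul, toAdd_ofAdd, nsmul_eq_mul]
      push_cast
      rw [ZMod.natCast_zmod_val]
      linear_combination -(Multiplicative.toAdd g) * h2
    rw [hg]
    exact hpow _

end Assembly

theorem mainTheorem1 (p : ℕ) [Fact p.Prime] (n k : ℕ) (hk : 0 < k) (hkn : k < n)
    [MulAction (Multiplicative (ZMod p)) (StdSphere n)]
    [ContinuousConstSMul (Multiplicative (ZMod p)) (StdSphere n)]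
    (hlin : IsLinearSphereAction (Multiplicative (ZMod p)) n)
    (hfix : IsStdSubsphere n k
      (MulAction.fixedPoints (Multiplicative (ZMod p)) (StdSphere n))) :
    (Odd n ∧ Odd k → equivariantTC (Multiplicative (ZMod p)) (StdSphere n) = 2) ∧
    (Even n ∨ Even k → equivariantTC (Multiplicative (ZMod p)) (StdSphere n) = 3) := by
  obtain ⟨ρ, hρ⟩ := exists_representation_of_sphere_action hlin
  obtain ⟨W, hWk, hWf⟩ := hfix
  have hW := mem_iff_fixed_of_sphere_action hρ hWf
  have hn : Module.finrank ℝ (EuclideanSpace ℝ (Fin (n + 1))) = n + 1 := by simp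
  refine ⟨fun ⟨hno, hko⟩ => le_antisymm ?_ two_le_equivariantTC_sphere,
    fun h => le_antisymm ?_ ?_⟩
  · obtain ⟨v, hvx, hv0, hvL⟩ := exists_equivariant_skew_injective_zmod
      (inner_linear_of_sphere_action hρ) hW (by rw [hWk]; exact hko.add_one)
      (by rw [hn]; exact hno.add_one)
    exact equivariantTC_le_two hρ hvx hv0 hvL
  · let b := stdOrthonormalBasis ℝ W
    -- Since `k > 0`, the fixed subspace has dimension `k + 1 ≥ 2` and contains two orthonormal
    -- vectors.
    let i₀ : Fin (Module.finrank ℝ W) := ⟨0, by omega⟩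
    let i₁ : Fin (Module.finrank ℝ W) := ⟨1, by omega⟩
    have hmem : ∀ x : W, ‖x‖ = 1 → (x : EuclideanSpace ℝ (Fin (n + 1))) ∈
        Metric.sphere (0 : EuclideanSpace ℝ (Fin (n + 1))) 1 := fun x hx => by simpa using hx
    have hfixed : ∀ (x : W) (hx : ‖x‖ = 1) (g : Multiplicative (ZMod p)),
        g • (⟨x, hmem x hx⟩ : StdSphere n) = ⟨x, hmem x hx⟩ := fun x hx g =>
      Subtype.ext ((hρ g _).trans ((hW x).1 x.2 g))
    exact equivariantTC_le_three hρ (e := ⟨b i₀, hmem _ (b.orthonormal.1 i₀)⟩)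
      (f := ⟨b i₁, hmem _ (b.orthonormal.1 i₁)⟩)
      (b.orthonormal.2 (by simp [i₀, i₁] : i₀ ≠ i₁)) 
      (hfixed _ (b.orthonormal.1 i₀)) (hfixed _ (b.orthonormal.1 i₁))
  · rcases h with h | h
    · exact three_le_equivariantTC_sphere (by rw [hn]; exact h.add_one)
    · exact three_le_equivariantTC_sphere_of_fixedPoints hWf (by rw [hWk]; exact h.add_one)
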